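/- Conventions. All orders are linear. Write $A\preceq B$ if there is an order-preserving injection $A\to B$; $A\trianglelefteq B$ if $A=\varnothing$ or there is an order-preserving surjection $B\to A$; and $A\vartriangleleft B$ if $A\trianglelefteq B$ and not $B\trianglelefteq A$. A Countryman line is an uncountable linear order $C$ such that $C^2$ with the product order is a union of countably many chains. A linear order $A$ is $\aleph_1$-dense if it is nonempty, has no endpoints, and $[a,b]$ has size $\aleph_1$ whenever $a<b$. A decomposition of $A$ is a $\subseteq$-increasing sequence $D=\langle D_\xi:\xi<\omega_1\rangle$ of countable subsets of $A$ that covers $A$ and satisfies $D_\xi=\bigcup_{\eta<\xi}D_\eta$ for limit $\xi$. The complementary intervals of $A\setminus D_\xi$ are the nonempty convex subsets of $A$ that are maximal with respect to having no point in $D_\xi$. Let $\mathscr L(A,D)$ (resp. $\hat{\mathscr L}(A,D)$) be the set of $\xi<\omega_1$ such that some (resp. every) complementary interval of $A\setminus D_\xi$ has a minimum, and let $\mathscr R(A,D)$ be the set of $\xi<\omega_1$ such that some complementary interval of $A\setminus D_\xi$ has a maximum. Proposition. Assume $\mathrm{MA}_{\aleph_1}$. (1) Let $\langle S_\alpha:\alpha<\omega_1\rangle$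 be a family of pairwise disjoint stationary subsets of $\omega_1$. There are a Countryman line $T$ and, for each $\alpha<\omega_1$, an $\aleph_1$-dense Countryman line $C^\alpha\preceq T$ with a decomposition $D^\alpha$ such that $$\hat{\mathscr L}(C^\alpha,D^\alpha)=\mathscr L(C^\alpha,D^\alpha)=\bigcup_{\xi<\alpha}S_\xi,\qquad \mathscr R(C^\alpha,D^\alpha)=\varnothing .$$ Moreover, for all $T$, $C^\alpha$, $D^\alpha$ $(\alpha<\omega_1)$ with these properties and all $\alpha<\beta<\omega_1$ we have $C^\beta\vartriangleleft C^\alpha$: there is an order-preserving surjection of $C^\alpha$ onto $C^\beta$, but none of $C^\beta$ onto $C^\alpha$. (2) Consequently there is a sequence $\langle C^\alpha:\alpha<\omega_1\rangle$ of Countryman lines such that $C^\beta\vartriangleleft C^\alpha$ whenever $\alpha<\beta<\omega_1$; that is, a strictly $\trianglelefteq$-decreasing chain of Countryman lines of length $\omega_1$. -/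

import Mathlib

open Set Cardinal Ordinal

universe u v

/-- The set `ω₁` of countable ordinals, with its usual order. -/
abbrev OmegaOne : Type 1 := Set.Iio (ω₁ : Ordinal.{0})

/-! ### Martin's Axiom for `ℵ₁` dense sets -/

/-- Two conditions are compatible if they have a common extension (stronger is smaller). -/
def Compatible {P : Type u} [Preorder P] (p q : P) : Prop :=
  ∃ r : P, r ≤ p ∧ r ≤ q

/-- The countable chain condition: every set of pairwise incompatible conditions is countable. -/
def IsCCC (P : Type u) [Preorder P] : Prop :=
  ∀ W : Set P, W.Pairwise (fun p q => ¬ Compatible p q) → W.Countable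

/-- Forcing density: every condition has an extension in `E`. -/
def IsForcingDense {P : Type u} [Preorder P] (E : Set P) : Prop :=
  ∀ p : P, ∃ q ∈ E, q ≤ p

/-- `MA_{ℵ₁}`: for every nonempty ccc preorder and every family of at most `ℵ₁` dense sets there is
a filter meeting all of them. -/
def MartinAxiomAlephOne : Prop :=
  ∀ (P : Type u) [Preorder P] [Nonempty P], IsCCC P →
    ∀ 𝓔 : Set (Set P), #𝓔 ≤ ℵ₁ → (∀ E ∈ 𝓔, IsForcingDense E) →
      ∃ G : Order.PFilter P, ∀ E ∈ 𝓔, ((G : Set P) ∩ E).Nonempty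

/-! ### Linear orders -/

/-- A Countryman line: an uncountable linear order whose square, with the product order, is a
union of countably many chains. -/
def IsCountryman (C : Type u) [LinearOrder C] : Prop :=
  Uncountable C ∧
    ∃ K : ℕ → Set (C × C), (∀ n, IsChain (· ≤ ·) (K n)) ∧ ⋃ n, K n = Set.univ

/-- `ℵ₁`-dense: nonempty, without endpoints, and `[a, b]` has size `ℵ₁` whenever `a < b`. -/
def IsAlephOneDense (A : Type u) [LinearOrder A] : Prop :=
  Nonempty A ∧ NoMinOrder A ∧ NoMaxOrder A ∧ ∀ a b : A, a < b → #(Set.Icc a b) = ℵ₁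

/-- `Embeds A B` is `A ⪯ B`: there is an order preserving injection of `A` into `B`. -/
def Embeds (A : Type u) (B : Type v) [LinearOrder A] [LinearOrder B] : Prop :=
  ∃ f : A → B, StrictMono f

/-- `EpiLE A B` is `A ⊴ B`: `A` is empty, or there is an epimorphism (an order preserving
surjection) from `B` onto `A`. -/
def EpiLE (A : Type u) (B : Type v) [LinearOrder A] [LinearOrder B] : Prop :=
  IsEmpty A ∨ ∃ f : B → A, Monotone f ∧ Function.Surjective f

/-- `EpiLT A B` is `A ◁ B`: `A ⊴ B` but not `B ⊴ A`. -/
def EpiLT (A : Type u) (B : Type v) [LinearOrder A] [LinearOrder B] : Prop :=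
  EpiLE A B ∧ ¬ EpiLE B A

/-! ### Decompositions -/

/-- A decomposition of `A`: an increasing, continuous `ω₁`-sequence of countable subsets of `A`
that covers `A`. -/
structure IsDecomposition {A : Type u} [LinearOrder A] (D : OmegaOne → Set A) : Prop where
  mono : Monotone D
  countable : ∀ ξ, (D ξ).Countable
  continuous : ∀ ξ, Order.IsSuccLimit ξ → D ξ = ⋃ η : Set.Iio ξ, D η
  covers : ⋃ ξ, D ξ = Set.univ

/-- `I` is a complementary interval of `A \ X`: an interval (a nonempty convex set) of `A`, maximal
among those that have no points in `X`. -/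
def IsComplementaryInterval {A : Type u} [LinearOrder A] (X I : Set A) : Prop :=
  Maximal (fun J : Set A => J.Nonempty ∧ J.OrdConnected ∧ Disjoint J X) I

/-- `ℒ(A, D)`: the `ξ` such that some complementary interval of `A \ D ξ` has a left endpoint. -/
def leftSet {A : Type u} [LinearOrder A] (D : OmegaOne → Set A) : Set OmegaOne :=
  {ξ | ∃ I, IsComplementaryInterval (D ξ) I ∧ ∃ a, IsLeast I a}

/-- `ℒ̂(A, D)`: the `ξ` such that every complementary interval of `A \ D ξ` has a left endpoint. -/
def leftHatSet {A : Type u} [LinearOrder A] (D : OmegaOne → Set A) : Set OmegaOne :=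
  {ξ | ∀ I, IsComplementaryInterval (D ξ) I → ∃ a, IsLeast I a}

/-- `ℛ(A, D)`: the `ξ` such that some complementary interval of `A \ D ξ` has a right endpoint. -/
def rightSet {A : Type u} [LinearOrder A] (D : OmegaOne → Set A) : Set OmegaOne :=
  {ξ | ∃ I, IsComplementaryInterval (D ξ) I ∧ ∃ a, IsGreatest I a}

/-- For a family `S` of subsets of `ω₁`: the lines `C α` (`α < ω₁`) are `ℵ₁`-dense Countryman
lines, all of them isomorphic to suborders of one Countryman line `T`, and `D α` is a decomposition
of `C α` with `ℒ̂(C α, D α) = ℒ(C α, D α) = ⋃_{ξ < α} S ξ` and `ℛ(C α, D α) = ∅`. -/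
structure IsCountrymanFamily (S : OmegaOne → Set OmegaOne) (T : Type u) [LinearOrder T]
    (C : OmegaOne → Type u) [∀ α, LinearOrder (C α)] (D : ∀ α, OmegaOne → Set (C α)) : Prop where
  countryman_ambient : IsCountryman T
  embeds : ∀ α, Embeds (C α) T
  countryman : ∀ α, IsCountryman (C α)
  dense : ∀ α, IsAlephOneDense (C α)
  decomposition : ∀ α, IsDecomposition (D α)
  left_eq : ∀ α, leftSet (D α) = ⋃ ξ : Set.Iio α, S ξ
  leftHat_eq : ∀ α, leftHatSet (D α) = ⋃ ξ : Set.Iio α, S ξ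
  right_eq : ∀ α, rightSet (D α) = ∅

/-! ### The countable ordinals -/

namespace OmegaOne

/-! The lines are lexicographic trees. Fix a coherent sequence `e` of finite-to-one functions on the
initial segments of a well-order consisting of a least element `i₀` and a copy of `ω₁`. A point of
level `i` is a finite modification of `e i` with positive rational values, a last value at `i`, and
`⊤` afterwards. Points of level at least `i` with a common restriction below `i` form a
complementary interval of the set of points of smaller level. It has no last point, since the value
at `i` can be raised below `⊤`; it has a first point exactly when the last value `⊥` is allowed at
`i`. Allowing `⊥` on the levels in `⋃_{ξ<α} S ξ` gives `C α`, and allowing it everywhere gives `T`.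
Coherence attaches to each pair of points a finite trace from a countable set of types, and pairs of
one type form a chain (`not_lt_and_gt_of_traceType_eq`). None of this uses Martin's Axiom.

An epimorphism `A → B` cannot exist if stationarily many `ξ` have minima in all complementary
intervals on the side of `A` and in none on the side of `B`: at a `ξ` closed under the map and under
countable cofinal subsets of its fibres, the minimum of an interval has nowhere to go
(`not_exists_epimorphism`). Applied to `S α`, this excludes a map of `C β` onto `C α` for `α < β`.

Martin's Axiom gives the epimorphism `C α → C β`. Along a club of ordinals the decompositions become
level functions (`exists_isLevelled`) that agree along the chains covering the product
(`exists_minLevel_le`). Finite partial isomorphisms preserve order, level and the least level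
between two points, and match first points on levels where both lines have them. This forcing is ccc
(`PartialIso.isCCC`). Each point of `B` can be added to the range. A point of `A` can be added to
the domain unless it lies in the class of, and below, a point already matched with a first point of
`B` (`exists_extension`); such points are collapsed to that first point, so the result is an
epimorphism rather than an isomorphism. -/

instance : Nonempty OmegaOne := ⟨⟨0, Ordinal.omega_pos 1⟩⟩

theorem countable_Iio (ξ : OmegaOne) : (Iio ξ).Countable := by
  have h : (Iio (ξ : Ordinal.{0})).Countable := by
    rw [← Cardinal.le_aleph0_iff_set_countable, Cardinal.mk_Iio_ordinal, Cardinal.lift_le_aleph0]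
    have h1 := Cardinal.lt_ord.1 (show (ξ : Ordinal.{0}) < (ℵ₁ : Cardinal.{0}).ord by
      rw [Cardinal.ord_aleph]; exact ξ.2)
    rwa [← Order.lt_succ_iff, Cardinal.succ_aleph0]
  refine (h.preimage (f := Subtype.val) Subtype.val_injective).mono ?_
  intro x hx
  exact hx

theorem exists_forall_lt {ι : Sort*} [Countable ι] (f : ι → OmegaOne) : ∃ b, ∀ i, f i < b := by
  have : Order.cof OmegaOne = ℵ₁ := by simp
  by_contra! h
  have hc : IsCofinal (range f) := by
    intro b
    obtain ⟨i, hi⟩ := h b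
    exact ⟨f i, ⟨i, rfl⟩, hi⟩
  have h1 := Order.cof_le hc
  rw [this] at h1
  have h2 : #(range f) ≤ ℵ₀ := Cardinal.le_aleph0_iff_set_countable.2 (countable_range f)
  exact absurd (h1.trans h2) (not_le.2 (by simp))

theorem exists_forall_mem_lt {X : Set OmegaOne} (hX : X.Countable) : ∃ b, ∀ x ∈ X, x < b := by
  have := hX.to_subtype
  obtain ⟨b, hb⟩ := exists_forall_lt (fun x : X => (x : OmegaOne))
  exact ⟨b, fun x hx => hb ⟨x, hx⟩⟩

theorem exists_forall_mem_image_lt {α : Type*} {X : Set α} (hX : X.Countable) (f : α → OmegaOne) :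
    ∃ b, ∀ x ∈ X, f x < b := by
  obtain ⟨b, hb⟩ := exists_forall_mem_lt (hX.image f)
  exact ⟨b, fun x hx => hb _ ⟨x, hx, rfl⟩⟩

instance : NoMaxOrder OmegaOne where
  exists_gt a := by
    obtain ⟨b, hb⟩ := exists_forall_lt (fun _ : Unit => a)
    exact ⟨b, hb ()⟩

noncomputable instance : OrderBot OmegaOne where
  bot := ⟨0, Ordinal.omega_pos 1⟩
  bot_le a := show (0 : Ordinal) ≤ a from bot_le

theorem not_countable_Ioi (ξ : OmegaOne) : ¬ (Ioi ξ).Countable := by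
  intro h
  obtain ⟨b, hb⟩ := exists_forall_mem_lt h
  obtain ⟨c, hc⟩ := exists_gt (max b ξ)
  exact absurd (hb c ((le_max_right _ _).trans_lt hc))
    (not_lt.2 ((le_max_left _ _).trans hc.le))

instance : Uncountable OmegaOne := by
  rw [← not_countable_iff]
  intro h
  exact not_countable_Ioi ⊥ (Set.to_countable _)

theorem countable_Iic (ξ : OmegaOne) : (Iic ξ).Countable := by
  obtain ⟨b, hb⟩ := exists_gt ξ
  exact (countable_Iio b).mono fun x hx => lt_of_le_of_lt hx hb

/-- The points closed under a function. -/
def closedPoints (Φ : OmegaOne → OmegaOne) : Set OmegaOne := {ξ | ∀ η < ξ, Φ η < ξ}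

/-- Least upper bounds of sets of countable ordinals with an upper bound. -/
theorem exists_isLUB {X : Set OmegaOne} (hX : BddAbove X) : ∃ s, IsLUB X s :=
  ⟨wellFounded_lt.min (upperBounds X) hX, WellFounded.min_mem _ _ _,
    fun _ hb => WellFounded.min_le _ hb⟩

theorem isLUB_mem_closedPoints {Φ : OmegaOne → OmegaOne} {X : Set OmegaOne}
    (hX : X ⊆ closedPoints Φ) {s : OmegaOne} (hs : IsLUB X s) : s ∈ closedPoints Φ := by
  intro η hη
  obtain ⟨e, he, h1⟩ := (lt_isLUB_iff hs).1 hη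
  exact (hX he η h1).trans_le (hs.1 he)

theorem exists_closedPoint_gt (Φ : OmegaOne → OmegaOne) (ζ : OmegaOne) :
    ∃ ξ ∈ closedPoints Φ, ζ < ξ := by
  have step : ∀ a : OmegaOne, ∃ b, a < b ∧ ∀ η ≤ a, Φ η < b := by
    intro a
    obtain ⟨b, hb⟩ := exists_forall_mem_image_lt (countable_Iic a) Φ
    obtain ⟨c, hc⟩ := exists_gt (max a b)
    exact ⟨c, (le_max_left _ _).trans_lt hc,
      fun η hη => (hb η hη).trans ((le_max_right _ _).trans_lt hc)⟩
  choose g hg hg' using step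
  let s : ℕ → OmegaOne := fun n => g^[n] ζ
  have hs : ∀ n, s (n + 1) = g (s n) := fun n => Function.iterate_succ_apply' g n ζ
  obtain ⟨b, hb⟩ := exists_forall_lt s
  obtain ⟨ξ, hξ⟩ := exists_isLUB (X := range s) ⟨b, by rintro _ ⟨n, rfl⟩; exact (hb n).le⟩
  have hlt : ∀ n, s n < ξ := fun n =>
    ((hs n).symm ▸ hg (s n) : s n < s (n + 1)).trans_le (hξ.1 ⟨n + 1, rfl⟩)
  refine ⟨ξ, fun η hη => ?_, hlt 0⟩
  obtain ⟨_, ⟨n, rfl⟩, h1⟩ := (lt_isLUB_iff hξ).1 hη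
  exact ((hs n).symm ▸ hg' (s n) η h1.le : Φ η < s (n + 1)).trans (hlt _)

theorem isClub_closedPoints (Φ : OmegaOne → OmegaOne) : IsClub (closedPoints Φ) := by
  refine ⟨fun X hX _ _ s hs => isLUB_mem_closedPoints hX hs, fun a => ?_⟩
  obtain ⟨ξ, h1, h2⟩ := exists_closedPoint_gt Φ a
  exact ⟨ξ, h1, h2.le⟩

theorem isClub_Ioi (ζ : OmegaOne) : IsClub (Ioi ζ) := by
  refine ⟨fun X hX hne _ s hs => ?_, fun a => ?_⟩
  · obtain ⟨x, hx⟩ := hne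
    exact (hX hx : ζ < x).trans_le (hs.1 hx)
  · obtain ⟨c, hc⟩ := exists_gt (max ζ a)
    exact ⟨c, (le_max_left _ _).trans_lt hc, ((le_max_right _ _).trans_lt hc).le⟩

theorem cof_ne : Order.cof OmegaOne ≠ ℵ₀ := by
  have : Order.cof OmegaOne = ℵ₁ := by simp
  rw [this]
  exact (Cardinal.aleph0_lt_aleph_one).ne'

theorem exists_mem_closedPoints_of_isStationary {S : Set OmegaOne} (hS : IsStationary S)
    (Φ : OmegaOne → OmegaOne) (ζ : OmegaOne) : ∃ ξ ∈ S, ξ ∈ closedPoints Φ ∧ ζ < ξ := by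
  obtain ⟨ξ, h1, h2, h3⟩ := hS ((isClub_closedPoints Φ).inter cof_ne (isClub_Ioi ζ))
  exact ⟨ξ, h1, h2, h3⟩

theorem isSuccLimit_of_mem_closedPoints {Φ : OmegaOne → OmegaOne} (hΦ : ∀ η, η < Φ η)
    {ξ : OmegaOne} (hξ : ξ ∈ closedPoints Φ) (h0 : ξ ≠ ⊥) : Order.IsSuccLimit ξ := by
  refine ⟨fun h => h0 h.eq_bot, fun η hη => ?_⟩
  exact hη.2 (hΦ η) (hξ η hη.1)

/-- The largest closed point that is at most `s`. -/
theorem exists_floor (Φ : OmegaOne → OmegaOne) (s : OmegaOne) :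
    ∃ t ∈ closedPoints Φ, ∀ e ∈ closedPoints Φ, e ≤ t ↔ e ≤ s := by
  obtain ⟨t, ht⟩ := exists_isLUB (X := closedPoints Φ ∩ Iic s) ⟨s, fun x hx => hx.2⟩
  refine ⟨t, isLUB_mem_closedPoints inter_subset_left ht, fun e he => ⟨fun h => ?_, fun h => ?_⟩⟩
  · exact h.trans (ht.2 fun x hx => hx.2)
  · exact ht.1 ⟨he, h⟩

noncomputable def floor (Φ : OmegaOne → OmegaOne) (s : OmegaOne) : OmegaOne :=
  (exists_floor Φ s).choose

theorem floor_mem (Φ : OmegaOne → OmegaOne) (s : OmegaOne) : floor Φ s ∈ closedPoints Φ :=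
  (exists_floor Φ s).choose_spec.1

theorem le_floor_iff {Φ : OmegaOne → OmegaOne} {s e : OmegaOne} (he : e ∈ closedPoints Φ) :
    e ≤ floor Φ s ↔ e ≤ s :=
  (exists_floor Φ s).choose_spec.2 e he

theorem floor_lt_iff {Φ : OmegaOne → OmegaOne} {s e : OmegaOne} (he : e ∈ closedPoints Φ) :
    floor Φ s < e ↔ s < e := by
  rw [← not_le, le_floor_iff he, not_le]

/-- If `s` were below the closed point `floor Φ t`, then so would be `Φ s`, hence `t`. Thus points
whose rank is bounded by `Φ` of the rank of their parameter never have a larger level than that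
parameter. -/
theorem floor_le_floor {Φ : OmegaOne → OmegaOne} {s t : OmegaOne} (h : t ≤ Φ s) :
    floor Φ t ≤ floor Φ s := by
  rw [le_floor_iff (floor_mem Φ t)]
  by_contra! hs
  have h1 := floor_mem Φ t s hs
  have h2 : floor Φ t ≤ t := (le_floor_iff (floor_mem Φ t)).1 le_rfl
  exact absurd (h2.trans h) (not_le.2 h1)

theorem floor_eq_self {Φ : OmegaOne → OmegaOne} {e : OmegaOne} (he : e ∈ closedPoints Φ) :
    floor Φ e = e :=
  le_antisymm ((le_floor_iff (floor_mem Φ e)).1 le_rfl) ((le_floor_iff he).2 le_rfl)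

/-- Ulam: `ω₁` many pairwise disjoint stationary sets. -/
theorem exists_disjoint_stationary : ∃ S : OmegaOne → Set OmegaOne,
    (∀ α, IsStationary (S α)) ∧ ∀ α β, α ≠ β → Disjoint (S α) (S β) := by
  have hinj : ∀ ξ : OmegaOne, ∃ f : OmegaOne → ℕ, InjOn f (Iio ξ) := fun ξ =>
    (countable_iff_exists_injOn).1 (countable_Iio ξ)
  choose f hf using hinj
  -- The Ulam matrix: each row is pairwise disjoint because `f ξ` is injective below `ξ`, and each
  -- column covers a final segment, so it has a stationary entry. Some row then has uncountably many
  -- stationary entries.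
  let U : ℕ → OmegaOne → Set OmegaOne := fun n α => {ξ | α < ξ ∧ f ξ α = n}
  have hst : ∀ α, ∃ n, IsStationary (U n α) := by
    intro α
    rw [← isStationary_iUnion_iff_of_countable cof_ne]
    refine ((isClub_Ioi α).isStationary cof_ne).mono fun ξ hξ => ?_
    exact mem_iUnion.2 ⟨f ξ α, hξ, rfl⟩
  choose n hn using hst
  obtain ⟨k, hk⟩ : ∃ k, ¬ (n ⁻¹' {k}).Countable := by
    by_contra! h
    have : (⋃ k, n ⁻¹' {k}).Countable := countable_iUnion h
    rw [← preimage_iUnion] at this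
    simp only [iUnion_of_singleton, preimage_univ] at this
    exact Set.not_countable_univ this
  have hunb : ∀ a : OmegaOne, ∃ b ∈ n ⁻¹' {k}, a < b := by
    intro a
    by_contra! h
    exact hk ((countable_Iic a).mono h)
  have hemb : ∃ g : OmegaOne → OmegaOne, StrictMono g ∧ ∀ a, g a ∈ n ⁻¹' {k} := by
    have hb : ∀ (a : OmegaOne) (h : ∀ b < a, OmegaOne), ∃ c ∈ n ⁻¹' {k},
        ∀ b (hb : b < a), h b hb < c := by
      intro a h
      have := (countable_Iio a).to_subtype
      obtain ⟨c, hc⟩ := exists_forall_lt (fun b : Iio a => h b.1 b.2)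
      obtain ⟨d, hd, hcd⟩ := hunb c
      exact ⟨d, hd, fun b hb => (hc ⟨b, hb⟩).trans hcd⟩
    choose c hc hc' using hb
    let g : OmegaOne → OmegaOne := wellFounded_lt.fix c
    have hg : ∀ a, g a = c a fun b _ => g b := fun a => wellFounded_lt.fix_eq c a
    refine ⟨g, fun b a hba => ?_, fun a => ?_⟩
    · rw [hg a]
      exact hc' a _ b hba
    · rw [hg a]
      exact hc a _
  obtain ⟨g, hg, hgk⟩ := hemb
  refine ⟨fun α => U k (g α), fun α => ?_, fun α β hαβ => ?_⟩
  · have := hn (g α)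
    rwa [show n (g α) = k from hgk α] at this
  · rw [Set.disjoint_left]
    rintro ξ ⟨h1, h2⟩ ⟨h3, h4⟩
    exact hαβ (hg.injective (hf ξ h1 h3 (h2.trans h4.symm)))

end OmegaOne

/-! ### Orders whose square is a countable union of chains -/

/-- The product `A × B` is a countable union of chains. -/
def IsChainCover {A : Type u} {B : Type v} [LinearOrder A] [LinearOrder B]
    (K : ℕ → Set (A × B)) : Prop :=
  (∀ n, IsChain (· ≤ ·) (K n)) ∧ ∀ q, ∃ n, q ∈ K n

namespace IsChainCover

variable {A : Type u} {B : Type v} [LinearOrder A] [LinearOrder B]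

theorem not_lt_and_gt {K : ℕ → Set (A × B)} (hK : IsChainCover K) {n : ℕ} {q r : A × B}
    (hq : q ∈ K n) (hr : r ∈ K n) : ¬ (q.1 < r.1 ∧ r.2 < q.2) := by
  rintro ⟨h1, h2⟩
  rcases (hK.1 n).total hq hr with h | h
  · exact absurd h.2 (not_le.2 h2)
  · exact absurd h.1 (not_le.2 h1)

theorem dual {K : ℕ → Set (A × B)} (hK : IsChainCover K) :
    IsChainCover (A := Aᵒᵈ) (B := Bᵒᵈ)
      fun n => {q | (OrderDual.ofDual q.1, OrderDual.ofDual q.2) ∈ K n} := by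
  refine ⟨fun n q hq r hr _ => ?_, fun q => hK.2 _⟩
  rcases (hK.1 n).total hq hr with h | h
  · exact Or.inr h
  · exact Or.inl h

theorem swap {K : ℕ → Set (A × B)} (hK : IsChainCover K) :
    IsChainCover fun n => {q : B × A | q.swap ∈ K n} := by
  refine ⟨fun n q hq r hr _ => ?_, fun q => hK.2 _⟩
  rcases (hK.1 n).total hq hr with h | h
  · exact Or.inl ⟨h.2, h.1⟩
  · exact Or.inr ⟨h.2, h.1⟩

theorem comap {A' : Type*} {B' : Type*} [LinearOrder A'] [LinearOrder B'] {K : ℕ → Set (A × B)}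
    (hK : IsChainCover K) {f : A' → A} {g : B' → B} (hf : StrictMono f) (hg : StrictMono g) :
    IsChainCover fun n => {q : A' × B' | (f q.1, g q.2) ∈ K n} := by
  refine ⟨fun n q hq r hr _ => ?_, fun q => hK.2 _⟩
  rcases (hK.1 n).total hq hr with h | h
  · exact Or.inl ⟨hf.le_iff_le.1 h.1, hg.le_iff_le.1 h.2⟩
  · exact Or.inr ⟨hf.le_iff_le.1 h.1, hg.le_iff_le.1 h.2⟩

/-- Otherwise, for each `x`, some chain contains `(x, y)` for cofinally many `y ∈ X`. Two points `x
< x'` of `X` share such a chain, and choosing `y'` for `x'` and then a larger `y` for `x`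
contradicts monotonicity. -/
theorem exists_countable_cofinal {K : ℕ → Set (A × A)} (hK : IsChainCover K) (X : Set A) :
    ∃ Q ⊆ X, Q.Countable ∧ ∀ x ∈ X, ∃ q ∈ Q, x ≤ q := by
  by_contra! h
  have hc : ∀ x, ∃ n, ∀ z ∈ X, ∃ y ∈ X, z < y ∧ (x, y) ∈ K n := by
    intro x
    by_contra! h1
    choose z hz hz' using h1
    obtain ⟨y, hy, hy'⟩ := h (range z) (by rintro _ ⟨n, rfl⟩; exact hz n) (countable_range z)
    obtain ⟨n, hn⟩ := hK.2 (x, y)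
    exact hz' n y hy (hy' _ ⟨n, rfl⟩) hn
  choose n hn using hc
  have huc : ¬ X.Countable := by
    intro hX
    obtain ⟨x, hx, h1⟩ := h X subset_rfl hX
    exact lt_irrefl _ (h1 x hx)
  obtain ⟨x, hx, x', hx', hne, heq⟩ : ∃ x ∈ X, ∃ x' ∈ X, x ≠ x' ∧ n x = n x' := by
    by_contra! h1
    refine huc (countable_iff_exists_injOn.2 ⟨n, fun a ha b hb hab => ?_⟩)
    by_contra h2
    exact h1 a ha b hb h2 hab
  wlog hlt : x < x' generalizing x x'
  · exact this x' hx' x hx hne.symm heq.symm (lt_of_le_of_ne (not_lt.1 hlt) hne.symm)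
  obtain ⟨y', hy', -, h1⟩ := hn x' x hx
  obtain ⟨y, hy, h2, h3⟩ := hn x y' hy'
  exact hK.not_lt_and_gt (heq ▸ h3) h1 ⟨hlt, h2⟩

theorem exists_countable_coinitial {K : ℕ → Set (A × A)} (hK : IsChainCover K) (X : Set A) :
    ∃ Q ⊆ X, Q.Countable ∧ ∀ x ∈ X, ∃ q ∈ Q, q ≤ x :=
  hK.dual.exists_countable_cofinal (A := Aᵒᵈ) X

end IsChainCover

/-- The points that are not separated from `a` by `X`. -/
def gapClass {A : Type u} [LinearOrder A] (X : Set A) (a : A) : Set A :=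
  {y | Disjoint (uIcc a y) X}

/-! ### Complementary intervals as equivalence classes -/

section gapClass

variable {A : Type u} [LinearOrder A] {X : Set A} {a b c : A}

theorem mem_gapClass_self (ha : a ∉ X) : a ∈ gapClass X a := by
  simpa [gapClass] using ha

theorem notMem_of_mem_gapClass (h : b ∈ gapClass X a) : b ∉ X :=
  Set.disjoint_left.1 h right_mem_uIcc

theorem mem_gapClass_comm : b ∈ gapClass X a ↔ a ∈ gapClass X b := by
  simp [gapClass, uIcc_comm]

theorem mem_gapClass_trans (h : b ∈ gapClass X a) (h' : c ∈ gapClass X b) : c ∈ gapClass X a := by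
  have : uIcc a c ⊆ uIcc a b ∪ uIcc b c := uIcc_subset_uIcc_union_uIcc
  exact (h.union_left h').mono_left this

theorem ordConnected_gapClass : (gapClass X a).OrdConnected := by
  refine ⟨fun x hx y hy z hz => ?_⟩
  have h1 : y ∈ gapClass X x := mem_gapClass_trans (mem_gapClass_comm.1 hx) hy
  refine mem_gapClass_trans hx (h1.mono_left ?_)
  rw [uIcc_of_le hz.1, uIcc_of_le (hz.1.trans hz.2)]
  exact Icc_subset_Icc_right hz.2

theorem isComplementaryInterval_gapClass (ha : a ∉ X) :
    IsComplementaryInterval X (gapClass X a) := by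
  refine ⟨⟨⟨a, mem_gapClass_self ha⟩, ordConnected_gapClass,
    Set.disjoint_left.2 fun x hx => notMem_of_mem_gapClass hx⟩, ?_⟩
  rintro J ⟨-, hJ, hJX⟩ hle x hx
  exact hJX.mono_left (hJ.uIcc_subset (hle (mem_gapClass_self ha)) hx)

theorem IsComplementaryInterval.eq_gapClass {I : Set A} (hI : IsComplementaryInterval X I)
    (ha : a ∈ I) : I = gapClass X a := by
  obtain ⟨⟨-, hc, hd⟩, hmax⟩ := hI
  have haX : a ∉ X := Set.disjoint_left.1 hd ha
  have hsub : I ⊆ gapClass X a := fun x hx => hd.mono_left (hc.uIcc_subset ha hx)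
  exact hsub.antisymm (hmax (isComplementaryInterval_gapClass haX).1 hsub)

theorem IsComplementaryInterval.exists_eq_gapClass {I : Set A} (hI : IsComplementaryInterval X I) :
    ∃ a ∉ X, I = gapClass X a := by
  obtain ⟨a, ha⟩ := hI.1.1
  exact ⟨a, Set.disjoint_left.1 hI.1.2.2 ha, hI.eq_gapClass ha⟩

/-- With uncountably many classes, each class `q` has a chain `n` and a separating point `c ∈ X`
such that `K n` pairs `q` with points on both sides of `c`. Two classes with the same `n` and `c`
yield pairs of `K n` in opposite order. -/
theorem IsChainCover.exists_countable_representatives {K : ℕ → Set (A × A)} (hK : IsChainCover K)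
    (hX : X.Countable) : ∃ R : Set A, R.Countable ∧ ∀ a ∉ X, ∃ r ∈ R, r ∈ gapClass X a := by
  classical
  let s : Setoid {a // a ∉ X} :=
    { r := fun a b => (b : A) ∈ gapClass X a
      iseqv := ⟨fun a => mem_gapClass_self a.2, fun h => mem_gapClass_comm.1 h,
        fun h h' => mem_gapClass_trans h h'⟩ }
  let rep : Quotient s → A := fun q => q.out
  have hsep : ∀ q r : Quotient s, q ≠ r → ∃ c ∈ X, c ∈ uIcc (rep q) (rep r) := by
    intro q r hqr
    by_contra! h
    refine hqr ?_
    rw [← Quotient.out_eq q, ← Quotient.out_eq r]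
    exact Quotient.sound (Set.disjoint_left.2 fun c hc hcX => h c hcX hc)
  have hnX : ∀ q, rep q ∉ X := fun q => q.out.2
  have hrinj : Function.Injective rep := fun q r h =>
    by_contra fun hqr => by
      obtain ⟨c, hc, hc'⟩ := hsep q r hqr
      rw [h, uIcc_self] at hc'
      exact hnX r (by rwa [← show c = rep r from hc'])
  refine ⟨range rep, ?_, fun a ha => ⟨_, ⟨Quotient.mk s ⟨a, ha⟩, rfl⟩, ?_⟩⟩
  swap
  · exact mem_gapClass_comm.1 (Quotient.mk_out (s := s) ⟨a, ha⟩)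
  rw [← Set.image_univ]
  refine Set.Countable.image ?_ _
  by_contra hunc
  have hex : ∀ q : Quotient s, ∃ nc : ℕ × X, ∃ r r' : Quotient s, (rep q, rep r) ∈ K nc.1 ∧
      (rep q, rep r') ∈ K nc.1 ∧ rep r < nc.2 ∧ nc.2 < rep r' := by
    intro q
    choose n hn using fun r => hK.2 (rep q, rep r)
    obtain ⟨r, r', hne, heq⟩ : ∃ r r', r ≠ r' ∧ n r = n r' := by
      by_contra! h1
      refine hunc (countable_iff_exists_injOn.2 ⟨n, fun a _ b _ hab => ?_⟩)
      by_contra h2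
      exact h1 a b h2 hab
    wlog hlt : rep r < rep r' generalizing r r'
    · exact this r' r hne.symm heq.symm
        (lt_of_le_of_ne (not_lt.1 hlt) fun h => hne (hrinj h.symm))
    obtain ⟨c, hc, hc'⟩ := hsep r r' hne
    rw [uIcc_of_le hlt.le] at hc'
    refine ⟨(n r, ⟨c, hc⟩), r, r', hn r, heq ▸ hn r', lt_of_le_of_ne hc'.1 ?_,
      lt_of_le_of_ne hc'.2 ?_⟩
    · rintro h; exact hnX r (h ▸ hc)
    · rintro h; exact hnX r' (h ▸ hc)
  choose nc r r' h1 h2 h3 h4 using hex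
  have := hX.to_subtype
  obtain ⟨q, q', hne, heq⟩ : ∃ q q', q ≠ q' ∧ nc q = nc q' := by
    by_contra! h
    have hinj : Function.Injective nc := fun a b hab => by_contra fun hne => h a b hne hab
    exact hunc (Set.countable_univ_iff.2 hinj.countable)
  wlog hlt : rep q < rep q' generalizing q q'
  · exact this q' q hne.symm heq.symm
      (lt_of_le_of_ne (not_lt.1 hlt) fun h => hne (hrinj h.symm))
  refine hK.not_lt_and_gt (heq ▸ h2 q) (h1 q') ⟨hlt, (h3 q').trans ?_⟩
  rw [← heq]
  exact h4 q

end gapClass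

theorem IsCountryman.exists_isChainCover {C : Type u} [LinearOrder C] (hC : IsCountryman C) :
    ∃ K : ℕ → Set (C × C), IsChainCover K := by
  obtain ⟨-, K, h1, h2⟩ := hC
  exact ⟨K, h1, fun q => mem_iUnion.1 (h2 ▸ mem_univ q)⟩

/-! ### Decompositions and their rank functions -/

namespace IsDecomposition

variable {A : Type u} [LinearOrder A] {D : OmegaOne → Set A}

theorem exists_mem (hD : IsDecomposition D) (a : A) : ∃ ξ, a ∈ D ξ :=
  mem_iUnion.1 (hD.covers ▸ mem_univ a)

theorem exists_rank (hD : IsDecomposition D) :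
    ∃ σ : A → OmegaOne, (∀ a ξ, a ∈ D ξ ↔ σ a ≤ ξ) ∧
      ∀ a ξ, Order.IsSuccLimit ξ → (a ∈ D ξ ↔ σ a < ξ) := by
  have h : ∀ a, ∃ σ, ∀ ξ, a ∈ D ξ ↔ σ ≤ ξ := by
    intro a
    have hne : {ξ | a ∈ D ξ}.Nonempty := hD.exists_mem a
    refine ⟨wellFounded_lt.min _ hne, fun ξ => ⟨fun h => ?_, fun h => ?_⟩⟩
    · exact WellFounded.min_le wellFounded_lt (s := {ξ | a ∈ D ξ}) h
    exact hD.mono h (WellFounded.min_mem wellFounded_lt _ hne)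
  choose σ hσ using h
  refine ⟨σ, hσ, fun a ξ hξ => ⟨fun h => ?_, fun h => (hσ a ξ).2 h.le⟩⟩
  rw [hD.continuous ξ hξ] at h
  obtain ⟨⟨η, hη⟩, h1⟩ := mem_iUnion.1 h
  exact ((hσ a η).1 h1).trans_lt hη

end IsDecomposition

/-- Bounding the ranks of countably many points attached to each ordinal. -/
theorem exists_bounding_function {A : Type u} (σ : A → OmegaOne) (N : OmegaOne → Set A)
    (hN : ∀ η, (N η).Countable) : ∃ Φ : OmegaOne → OmegaOne, ∀ η, ∀ y ∈ N η, σ y ≤ Φ η := by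
  choose Φ hΦ using fun η => OmegaOne.exists_forall_mem_image_lt (hN η) σ
  exact ⟨Φ, fun η y hy => (hΦ η y hy).le⟩

/-- At a suitable `ξ`, the stages are closed under `f` and under cofinal subsets of fibres. The
minimum `a` of an interval of `A` can neither be mapped into the corresponding interval of `B`,
which has no minimum, nor below it, because a fibre over a point of `F ξ` cannot have points on or
above `a`. -/
theorem not_exists_epimorphism {A B : Type u} [LinearOrder A] [LinearOrder B]
    {D : OmegaOne → Set A} {F : OmegaOne → Set B} (hA : IsCountryman A) (hB : IsCountryman B)
    (hD : IsDecomposition D) (hF : IsDecomposition F)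
    (hst : IsStationary (leftHatSet D \ leftSet F)) :
    ¬ ∃ f : A → B, Monotone f ∧ Function.Surjective f := by
  rintro ⟨f, hf, hsurj⟩
  obtain ⟨K, hK⟩ := hA.exists_isChainCover
  obtain ⟨σ, hσ, hσl⟩ := hD.exists_rank
  obtain ⟨τ, hτ, hτl⟩ := hF.exists_rank
  choose Q hQs hQc hQ using fun b => hK.exists_countable_cofinal (f ⁻¹' {b})
  obtain ⟨Φ, hΦ⟩ := exists_bounding_function σ (fun η => ⋃ b ∈ F η, Q b)
    fun η => (hF.countable η).biUnion fun b _ => hQc b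
  obtain ⟨Ψ, hΨ⟩ := exists_bounding_function τ (fun η => f '' D η)
    fun η => (hD.countable η).image f
  choose s hs using fun ξ : OmegaOne => exists_gt ξ
  obtain ⟨ξ, ⟨hξ1, hξ2⟩, hcl, hpos⟩ := OmegaOne.exists_mem_closedPoints_of_isStationary hst
    (fun η => max (max (Φ η) (Ψ η)) (s η)) ⊥
  have hlim : Order.IsSuccLimit ξ := OmegaOne.isSuccLimit_of_mem_closedPoints
    (fun η => (hs η).trans_le (le_max_right _ _)) hcl hpos.ne'
  have hQD : ∀ d ∈ F ξ, Q d ⊆ D ξ := by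
    intro d hd y hy
    have h1 := (hτl d ξ hlim).1 hd
    refine (hσ y ξ).2 ((hΦ (τ d) y (mem_biUnion ((hτ d _).2 le_rfl) hy)).trans ?_)
    exact ((le_max_left _ _).trans (le_max_left _ _)).trans (hcl _ h1).le
  have hfD : ∀ x ∈ D ξ, f x ∈ F ξ := by
    intro x hx
    have h1 := (hσl x ξ hlim).1 hx
    refine (hτ _ ξ).2 ((hΨ (σ x) _ ⟨x, (hσ x _).2 le_rfl, rfl⟩).trans ?_)
    exact ((le_max_right _ _).trans (le_max_left _ _)).trans (hcl _ h1).le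
  obtain ⟨y, hy⟩ : ∃ y, y ∉ F ξ := by
    by_contra! h
    have := hB.1
    refine Set.not_countable_univ (α := B) ((hF.countable ξ).mono fun y _ => h y)
  obtain ⟨x, rfl⟩ := hsurj y
  have hx : x ∉ D ξ := fun h => hy (hfD x h)
  obtain ⟨a, ha, hamin⟩ := hξ1 _ (isComplementaryInterval_gapClass hx)
  have hpre : ∀ z, f z ∈ gapClass (F ξ) (f x) → z ∈ gapClass (D ξ) x := by
    intro z hz
    refine Set.disjoint_left.2 fun w hw hwD => ?_
    refine Set.disjoint_left.1 hz ?_ (hfD w hwD)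
    exact hf.image_uIcc_subset (mem_image_of_mem f hw)
  have hax : a ≤ x := hamin (mem_gapClass_self hx)
  -- The preimage of the interval of `f x` lies in the interval of `x`, so if `f a` belonged to the
  -- former it would be its minimum.
  have hfa : f a ∉ gapClass (F ξ) (f x) := by
    intro h
    refine hξ2 ⟨_, isComplementaryInterval_gapClass hy, f a, h, ?_⟩
    intro z hz
    obtain ⟨w, rfl⟩ := hsurj z
    exact hf (hamin (hpre w hz))
  obtain ⟨d, hd, hdF⟩ : ∃ d ∈ uIcc (f x) (f a), d ∈ F ξ := Set.not_disjoint_iff.1 hfa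
  rw [uIcc_of_ge (hf hax)] at hd
  have hdx : d < f x := lt_of_le_of_ne hd.2 fun h => hy (h ▸ hdF)
  -- A fibre point on or above `a` would lie below some `c ∈ Q d ⊆ D ξ` with `c < x`, and `c` would
  -- separate `a` from `x`. Hence `d ≤ f a`, so `f a = d`, and applying this to `a` itself gives `a
  -- < a`.
  have key : ∀ e, f e = d → e < a := by
    intro e he
    obtain ⟨c, hc, hec⟩ := hQ d e he
    have hcx : c < x := by
      by_contra! h
      have := hf h
      rw [show f c = d from hQs d hc] at this
      exact absurd this (not_le.2 hdx)
    have hcD : c ∈ D ξ := hQD d hdF hc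
    by_contra! hae
    have hc' : c ∈ uIcc x a := by
      rw [uIcc_of_ge hax]
      exact ⟨hae.trans hec, hcx.le⟩
    exact Set.disjoint_left.1 ha hc' hcD
  obtain ⟨e, he⟩ := hsurj d
  have h1 : d ≤ f a := he ▸ hf (key e he).le
  exact lt_irrefl _ (key a (le_antisymm hd.1 h1))

/-! ### Levelled linear orders -/

section MinLevel

variable {A : Type*} {ι : Type*} [LinearOrder A] [LinearOrder ι] [WellFoundedLT ι]

/-- The least level of a point between `x` and `y`. -/
noncomputable def minLevel (l : A → ι) (x y : A) : ι :=
  wellFounded_lt.min (l '' uIcc x y) (nonempty_uIcc.image l)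

variable {l : A → ι} {x y z a : A} {ξ : ι}

theorem exists_level_eq_minLevel (l : A → ι) (x y : A) : ∃ c ∈ uIcc x y, l c = minLevel l x y :=
  WellFounded.min_mem wellFounded_lt (l '' uIcc x y) (nonempty_uIcc.image l)

theorem minLevel_le_of_mem (h : z ∈ uIcc x y) : minLevel l x y ≤ l z :=
  WellFounded.min_le wellFounded_lt (mem_image_of_mem l h)

theorem le_minLevel : ξ ≤ minLevel l x y ↔ ∀ c ∈ uIcc x y, ξ ≤ l c := by
  refine ⟨fun h c hc => h.trans (minLevel_le_of_mem hc), fun h => ?_⟩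
  obtain ⟨c, hc, h1⟩ := exists_level_eq_minLevel l x y
  exact h1 ▸ h c hc

theorem minLevel_comm (l : A → ι) (x y : A) : minLevel l x y = minLevel l y x := by
  refine le_antisymm (le_minLevel.2 fun c hc => minLevel_le_of_mem ?_)
    (le_minLevel.2 fun c hc => minLevel_le_of_mem ?_) <;> rwa [uIcc_comm]

theorem minLevel_self (l : A → ι) (x : A) : minLevel l x x = l x := by
  obtain ⟨c, hc, h⟩ := exists_level_eq_minLevel l x x
  rw [← h, show c = x by simpa using hc]

theorem minLevel_le_left (l : A → ι) (x y : A) : minLevel l x y ≤ l x :=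
  minLevel_le_of_mem left_mem_uIcc

theorem minLevel_le_right (l : A → ι) (x y : A) : minLevel l x y ≤ l y :=
  minLevel_le_of_mem right_mem_uIcc

theorem minLevel_anti (h : uIcc x y ⊆ uIcc z a) : minLevel l z a ≤ minLevel l x y :=
  le_minLevel.2 fun _ hc => minLevel_le_of_mem (h hc)

theorem min_minLevel_le (l : A → ι) (x y z : A) :
    min (minLevel l x y) (minLevel l y z) ≤ minLevel l x z := by
  refine le_minLevel.2 fun c hc => ?_
  rcases uIcc_subset_uIcc_union_uIcc (b := y) hc with h | h
  · exact (min_le_left _ _).trans (minLevel_le_of_mem h)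
  · exact (min_le_right _ _).trans (minLevel_le_of_mem h)

theorem minLevel_eq_min_of_mem (h : y ∈ uIcc x z) :
    minLevel l x z = min (minLevel l x y) (minLevel l y z) :=
  le_antisymm (le_min (minLevel_anti (uIcc_subset_uIcc_left h))
    (minLevel_anti (uIcc_subset_uIcc_right h))) (min_minLevel_le l x y z)

theorem mem_uIcc_of_le' (h1 : x ≤ y) (h2 : y ≤ z) : y ∈ uIcc x z := by
  rw [uIcc_of_le (h1.trans h2)]; exact ⟨h1, h2⟩

theorem minLevel_eq_min (h1 : x ≤ y) (h2 : y ≤ z) :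
    minLevel l x z = min (minLevel l x y) (minLevel l y z) :=
  minLevel_eq_min_of_mem (mem_uIcc_of_le' h1 h2)

/-- `a` is the first point of the class of points which no point of smaller level separates
from `a`. -/
def IsFirst (l : A → ι) (a : A) : Prop := ∀ x < a, minLevel l x a < l a

theorem not_isFirst (h : x < a) (h' : l a ≤ minLevel l x a) : ¬ IsFirst l a :=
  fun hf => absurd (hf x h) (not_lt.2 h')

end MinLevel

/-- A linear order with levels in `E`, such that the classes of points that are not separated by
points of smaller level have no last point, and have a first point exactly on the levels in `L`. -/
structure IsLevelled {A : Type*} {ι : Type*} [LinearOrder A] [LinearOrder ι] [WellFoundedLT ι]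
    (l : A → ι) (E L : Set ι) : Prop where
  mem : ∀ a, l a ∈ E
  countable : ∀ ξ, {a | l a < ξ}.Countable
  exists_between : ∀ x y, x < y → ∃ z, x < z ∧ z < y ∧ l z = minLevel l x y
  exists_between_eq : ∀ x y, ∀ ξ ∈ E, x < y → l x < ξ → l y < ξ → ∃ z, x < z ∧ z < y ∧ l z = ξ
  exists_gt : ∀ a, ∀ ξ ∈ E, ξ ≤ l a → ∃ c, a < c ∧ l c = ξ ∧ minLevel l a c = ξ
  exists_lt : ∀ a, ∀ ξ ∈ E, ξ ∉ L → ξ ≤ l a → ∃ c, c < a ∧ l c = ξ ∧ minLevel l c a = ξ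
  exists_first : ∀ a, ∀ ξ ∈ E, ξ ∈ L → ξ ≤ l a →
    ∃ m, m ≤ a ∧ l m = ξ ∧ minLevel l m a = ξ ∧ IsFirst l m
  exists_level : ∀ ξ ∈ E, ∃ a, l a = ξ

namespace IsLevelled

variable {A : Type*} {ι : Type*} [LinearOrder A] [LinearOrder ι] [WellFoundedLT ι]
  {l : A → ι} {E L : Set ι}

theorem mem_of_isFirst (h : IsLevelled l E L) {a : A} (ha : IsFirst l a) : l a ∈ L := by
  by_contra hL
  obtain ⟨c, hc, -, h1⟩ := h.exists_lt a _ (h.mem a) hL le_rfl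
  exact not_isFirst hc h1.ge ha

/-- Points of a large level, of prescribed kind, between two points. -/
theorem exists_kind_between (h : IsLevelled l E L) {c c' : A} {ξ : ι} (hξ : ξ ∈ E) (hcc : c < c')
    (hc : l c < ξ) (hc' : l c' < ξ) (t : Prop) :
    ∃ z, c < z ∧ z < c' ∧ l z = ξ ∧ (ξ ∈ L → (IsFirst l z ↔ t)) := by
  obtain ⟨z, h1, h2, h3⟩ := h.exists_between_eq c c' ξ hξ hcc hc hc'
  by_cases hL : ξ ∈ L
  swap
  · exact ⟨z, h1, h2, h3, fun h => absurd h hL⟩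
  obtain ⟨m, hm, hlm, hmz, hmf⟩ := h.exists_first z ξ hξ hL h3.ge
  have hcm : c < m := by
    by_contra! hmc
    have := minLevel_le_of_mem (l := l) (mem_uIcc_of_le' hmc h1.le)
    exact absurd (hmz ▸ this) (not_le.2 hc)
  by_cases ht : t
  · exact ⟨m, hcm, hm.trans_lt h2, hlm, fun _ => by simp [ht, hmf]⟩
  obtain ⟨w, hw, hlw, hmw⟩ := h.exists_gt m ξ hξ hlm.ge
  refine ⟨w, hcm.trans hw, ?_, hlw, fun _ => by
    simpa [ht] using not_isFirst hw (hlw.trans hmw.symm).le⟩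
  by_contra! hwc
  have := minLevel_le_of_mem (l := l) (mem_uIcc_of_le' (hm.trans h2.le) hwc)
  exact absurd (hmw ▸ this) (not_le.2 hc')

theorem exists_kind (h : IsLevelled l E L) {ξ : ι} (hξ : ξ ∈ E) (t : Prop) :
    ∃ z, l z = ξ ∧ (ξ ∈ L → (IsFirst l z ↔ t)) := by
  obtain ⟨z, hz⟩ := h.exists_level ξ hξ
  by_cases hL : ξ ∈ L
  swap
  · exact ⟨z, hz, fun h => absurd h hL⟩
  obtain ⟨m, hm, hlm, -, hmf⟩ := h.exists_first z ξ hξ hL hz.ge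
  by_cases ht : t
  · exact ⟨m, hlm, fun _ => by simp [ht, hmf]⟩
  obtain ⟨w, hw, hlw, hmw⟩ := h.exists_gt m ξ hξ hlm.ge
  exact ⟨w, hlw, fun _ => by simpa [ht] using not_isFirst hw (hlw.trans hmw.symm).le⟩

/-- Two points `c < c'` of the least level are placed inside the interval; anything between them is
separated from `a` and from `b` on exactly that level. If `ξ = μ`, the point `a` precedes the new
point in its class, so the new point cannot be first; hence the condition `ht`. -/
theorem exists_kind_Ioo (h : IsLevelled l E L) {a b : A} {ξ μ : ι} (hξ : ξ ∈ E) (hab : a < b)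
    (hμ : minLevel l a b = μ) (hμξ : μ ≤ ξ) (t : Prop) (ht : ξ = μ → ¬ t) :
    ∃ z, a < z ∧ z < b ∧ l z = ξ ∧ minLevel l a z = μ ∧ minLevel l z b = μ ∧
      (ξ ∈ L → (IsFirst l z ↔ t)) := by
  obtain ⟨c, h1, h2, h3⟩ := h.exists_between a b hab
  obtain ⟨c', h4, h5, h6⟩ := h.exists_between c b h2
  have hcb : minLevel l c b = μ := by
    refine le_antisymm ((minLevel_le_left l c b).trans (h3.trans hμ).le) ?_
    rw [← hμ]
    exact minLevel_anti (uIcc_subset_uIcc_right (mem_uIcc_of_le' h1.le h2.le))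
  rw [hμ] at h3
  rw [hcb] at h6
  have key : ∀ z, c ≤ z → z ≤ c' → minLevel l a z = μ ∧ minLevel l z b = μ := by
    intro z hz hz'
    have h7 : minLevel l a b ≤ minLevel l a z :=
      minLevel_anti (uIcc_subset_uIcc_left (mem_uIcc_of_le' (h1.le.trans hz) (hz'.trans h5.le)))
    have h8 : minLevel l a b ≤ minLevel l z b :=
      minLevel_anti (uIcc_subset_uIcc_right (mem_uIcc_of_le' (h1.le.trans hz) (hz'.trans h5.le)))
    have h9 := minLevel_le_of_mem (l := l) (mem_uIcc_of_le' h1.le hz)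
    have h10 := minLevel_le_of_mem (l := l) (mem_uIcc_of_le' hz' h5.le)
    rw [hμ] at h7 h8
    exact ⟨le_antisymm (h9.trans h3.le) h7, le_antisymm (h10.trans h6.le) h8⟩
  rcases hμξ.eq_or_lt with rfl | hlt
  · refine ⟨c, h1, h2, h3, (key c le_rfl h4.le).1, (key c le_rfl h4.le).2, fun _ => ?_⟩
    have := not_isFirst h1 (h3.trans (key c le_rfl h4.le).1.symm).le
    simp [this, ht]
  · obtain ⟨z, h7, h8, h9, h10⟩ :=
      h.exists_kind_between hξ h4 (h3.trans_lt hlt) (h6.trans_lt hlt) t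
    exact ⟨z, h1.trans h7, h8.trans h5, h9, (key z h7.le h8.le).1, (key z h7.le h8.le).2, h10⟩

theorem exists_kind_gt (h : IsLevelled l E L) {a : A} {ξ μ : ι} (hξ : ξ ∈ E) (hμE : μ ∈ E)
    (hμ : μ ≤ l a) (hμξ : μ ≤ ξ) (t : Prop) (ht : ξ = μ → ¬ t) :
    ∃ z, a < z ∧ l z = ξ ∧ minLevel l a z = μ ∧ (ξ ∈ L → (IsFirst l z ↔ t)) := by
  obtain ⟨b, hb, -, hab⟩ := h.exists_gt a μ hμE hμ
  obtain ⟨z, h1, -, h2, h3, -, h4⟩ := h.exists_kind_Ioo hξ hb hab hμξ t ht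
  exact ⟨z, h1, h2, h3, h4⟩

/-- The only obstruction to going down inside the class of `b` at level `μ` is that `b` is itself
the first point of that class. This is the sole source of failure in the extension property. -/
theorem exists_kind_lt (h : IsLevelled l E L) {b : A} {ξ μ : ι} (hξ : ξ ∈ E) (hμE : μ ∈ E)
    (hμ : μ ≤ l b) (hμξ : μ ≤ ξ) (t : Prop) :
    (∃ z, z < b ∧ l z = ξ ∧ minLevel l z b = μ ∧ (ξ ∈ L → (IsFirst l z ↔ t))) ∨
      (IsFirst l b ∧ l b = μ) := by
  by_cases hL : μ ∈ L
  · obtain ⟨m, hm, hlm, hmb, hmf⟩ := h.exists_first b μ hμE hL hμ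
    rcases hm.eq_or_lt with rfl | hlt
    · exact Or.inr ⟨hmf, hlm⟩
    refine Or.inl ?_
    by_cases hξt : ξ = μ ∧ t
    · obtain ⟨rfl, ht⟩ := hξt
      exact ⟨m, hlt, hlm, hmb, fun _ => by simp [hmf, ht]⟩
    · obtain ⟨z, -, h1, h2, -, h3, h4⟩ := h.exists_kind_Ioo hξ hlt hmb hμξ t
        (fun h1 h2 => hξt ⟨h1, h2⟩)
      exact ⟨z, h1, h2, h3, h4⟩
  · obtain ⟨c, hc, hlc, hcb⟩ := h.exists_lt b μ hμE hL hμ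
    refine Or.inl ?_
    by_cases hξμ : ξ = μ
    · subst hξμ
      exact ⟨c, hc, hlc, hcb, fun h => absurd h hL⟩
    · obtain ⟨z, -, h1, h2, -, h3, h4⟩ := h.exists_kind_Ioo hξ hc hcb hμξ t
        (fun h1 => absurd h1 hξμ)
      exact ⟨z, h1, h2, h3, h4⟩

end IsLevelled

/-! ### Finite partial isomorphisms of levelled orders -/

section Compat

variable {A B ι : Type*} [LinearOrder A] [LinearOrder B] [LinearOrder ι] [WellFoundedLT ι]

/-- The pairs `q` and `r` may belong to a common partial isomorphism. -/
structure CompatPairs (l : A → ι) (k : B → ι) (q r : A × B) : Prop where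
  lt_iff : q.1 < r.1 ↔ q.2 < r.2
  gt_iff : r.1 < q.1 ↔ r.2 < q.2
  minLevel_eq : minLevel l q.1 r.1 = minLevel k q.2 r.2

/-- The pair `q` may belong to a partial isomorphism; the kind of its points has to agree on the
levels in `M`. -/
structure GoodPair (l : A → ι) (k : B → ι) (M : Set ι) (q : A × B) : Prop where
  level_eq : l q.1 = k q.2
  first_iff : l q.1 ∈ M → (IsFirst l q.1 ↔ IsFirst k q.2)

variable {l : A → ι} {k : B → ι} {M : Set ι} {q r s : A × B}

theorem CompatPairs.symm (h : CompatPairs l k q r) : CompatPairs l k r q :=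
  ⟨h.gt_iff, h.lt_iff, by rw [minLevel_comm l, minLevel_comm k, h.minLevel_eq]⟩

theorem CompatPairs.swap (h : CompatPairs l k q r) : CompatPairs k l q.swap r.swap :=
  ⟨h.lt_iff.symm, h.gt_iff.symm, h.minLevel_eq.symm⟩

theorem GoodPair.swap (h : GoodPair l k M q) : GoodPair k l M q.swap :=
  ⟨h.level_eq.symm, fun h1 => (h.first_iff (h.level_eq ▸ h1)).symm⟩

theorem GoodPair.compatPairs_self (h : GoodPair l k M q) : CompatPairs l k q q :=
  ⟨by simp, by simp, by rw [minLevel_self, minLevel_self, h.level_eq]⟩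

theorem CompatPairs.eq_iff (h : CompatPairs l k q r) : q.1 = r.1 ↔ q.2 = r.2 := by
  rw [le_antisymm_iff, le_antisymm_iff, ← not_lt, ← not_lt, ← not_lt, ← not_lt, h.lt_iff, h.gt_iff]

theorem CompatPairs.le_iff (h : CompatPairs l k q r) : q.1 ≤ r.1 ↔ q.2 ≤ r.2 := by
  rw [← not_lt, ← not_lt, h.gt_iff]

theorem compatPairs_of_lt (h1 : q.1 < r.1) (h2 : q.2 < r.2)
    (h3 : minLevel l q.1 r.1 = minLevel k q.2 r.2) : CompatPairs l k q r :=
  ⟨iff_of_true h1 h2, iff_of_false h1.not_gt h2.not_gt, h3⟩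

theorem CompatPairs.trans_lt (h : CompatPairs l k q r) (h' : CompatPairs l k r s)
    (hqr : q.1 ≤ r.1) (hrs : r.1 < s.1) : CompatPairs l k q s := by
  have h1 := h.le_iff.1 hqr
  have h2 := h'.lt_iff.1 hrs
  refine compatPairs_of_lt (hqr.trans_lt hrs) (h1.trans_lt h2) ?_
  rw [minLevel_eq_min hqr hrs.le, minLevel_eq_min h1 h2.le, h.minLevel_eq, h'.minLevel_eq]

variable {E L L' : Set ι}

/-- The one point extension property. -/
theorem exists_extension (hA : IsLevelled l E L) (hB : IsLevelled k E L') (p : Finset (A × B))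
    (hp : ∀ q ∈ p, GoodPair l k (L ∩ L') q) (hpp : ∀ q ∈ p, ∀ r ∈ p, CompatPairs l k q r) (x : A) :
    (∃ y, GoodPair l k (L ∩ L') (x, y) ∧ ∀ q ∈ p, CompatPairs l k q (x, y)) ∨
      ∃ q ∈ p, x < q.1 ∧ IsFirst k q.2 ∧ minLevel l x q.1 = l q.1 ∧ l q.1 ∉ L := by
  classical
  by_cases hx : ∃ q ∈ p, q.1 = x
  · obtain ⟨q, hq, rfl⟩ := hx
    exact Or.inl ⟨q.2, hp q hq, fun r hr => hpp r hr q hq⟩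
  push Not at hx
  have hlow : (∀ q ∈ p, x < q.1) ∨ ∃ r ∈ p, r.1 < x ∧ ∀ q ∈ p, q.1 < x → q.1 ≤ r.1 := by
    by_cases hne : (p.filter fun q => q.1 < x).Nonempty
    · obtain ⟨r, hr, h1⟩ := Finset.exists_max_image _ Prod.fst hne
      rw [Finset.mem_filter] at hr
      exact Or.inr ⟨r, hr.1, hr.2, fun q hq hqx => h1 q (Finset.mem_filter.2 ⟨hq, hqx⟩)⟩
    · refine Or.inl fun q hq => ?_
      by_contra! h
      exact hne ⟨q, Finset.mem_filter.2 ⟨hq, lt_of_le_of_ne h (hx q hq)⟩⟩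
  have hhigh : (∀ q ∈ p, q.1 < x) ∨ ∃ r ∈ p, x < r.1 ∧ ∀ q ∈ p, x < q.1 → r.1 ≤ q.1 := by
    by_cases hne : (p.filter fun q => x < q.1).Nonempty
    · obtain ⟨r, hr, h1⟩ := Finset.exists_min_image _ Prod.fst hne
      rw [Finset.mem_filter] at hr
      exact Or.inr ⟨r, hr.1, hr.2, fun q hq hqx => h1 q (Finset.mem_filter.2 ⟨hq, hqx⟩)⟩
    · refine Or.inl fun q hq => ?_
      by_contra! h
      exact hne ⟨q, Finset.mem_filter.2 ⟨hq, lt_of_le_of_ne h (hx q hq).symm⟩⟩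
  have fromLow : ∀ y, ∀ r ∈ p, (∀ q ∈ p, q.1 < x → q.1 ≤ r.1) → r.1 < x →
      CompatPairs l k r (x, y) → ∀ q ∈ p, q.1 < x → CompatPairs l k q (x, y) :=
    fun y r hr hmax hrx hc q hq hqx => (hpp q hq r hr).trans_lt hc (hmax q hq hqx) hrx
  have fromHigh : ∀ y, ∀ r ∈ p, (∀ q ∈ p, x < q.1 → r.1 ≤ q.1) → x < r.1 →
      CompatPairs l k (x, y) r → ∀ q ∈ p, x < q.1 → CompatPairs l k q (x, y) := by
    intro y r hr hmin hrx hc q hq hqx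
    rcases (hmin q hq hqx).eq_or_lt with h | h
    · have h2 := (hpp r hr q hq).eq_iff.1 h
      rw [← show r = q from Prod.ext h h2]
      exact hc.symm
    · exact (hc.trans_lt (hpp r hr q hq) hrx.le h).symm
  have good : ∀ y, k y = l x → (l x ∈ L' → (IsFirst k y ↔ IsFirst l x)) →
      GoodPair l k (L ∩ L') (x, y) :=
    fun y h1 h2 => ⟨h1.symm, fun h => (h2 h.2).symm⟩
  have hxE := hA.mem x
  have hmE : ∀ z, minLevel l x z ∈ E := fun z => by
    obtain ⟨c, -, hc⟩ := exists_level_eq_minLevel l x z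
    exact hc ▸ hA.mem c
  have hcases : ∀ q ∈ p, q.1 < x ∨ x < q.1 := fun q hq => lt_or_gt_of_ne (hx q hq)
  rcases hlow with hlow | ⟨r, hr, hrx, hrmax⟩
  · rcases hhigh with hhigh | ⟨s, hs, hxs, hsmin⟩
    · obtain ⟨y, hy, hy'⟩ := hB.exists_kind hxE (IsFirst l x)
      exact Or.inl ⟨y, good y hy hy', fun q hq => absurd (hlow q hq) (hhigh q hq).not_gt⟩
    · rcases hB.exists_kind_lt (b := s.2) hxE (hmE s.1)
        ((minLevel_le_right l x s.1).trans (hp s hs).level_eq.le) (minLevel_le_left l x s.1)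
        (IsFirst l x) with ⟨y, h1, h2, h3, h4⟩ | ⟨h1, h2⟩
      · exact Or.inl ⟨y, good y h2 h4, fun q hq => fromHigh y s hs hsmin hxs
          (compatPairs_of_lt hxs h1 h3.symm) q hq (hlow q hq)⟩
      · rw [← (hp s hs).level_eq] at h2
        -- If the level were in `L`, it would be in `L ∩ L'`, so `s.1` would be first as well,
        -- although `x` precedes it in its class.
        refine Or.inr ⟨s, hs, hxs, h1, h2.symm, fun hL => ?_⟩
        have hL' : l s.1 ∈ L' := (hp s hs).level_eq ▸ hB.mem_of_isFirst h1
        exact not_isFirst hxs h2.le (((hp s hs).first_iff ⟨hL, hL'⟩).2 h1)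
  · have hnf : l x = minLevel l r.1 x → ¬ IsFirst l x := fun h => not_isFirst hrx h.le
    have hlr : minLevel l r.1 x ≤ k r.2 :=
      (minLevel_le_left l r.1 x).trans (hp r hr).level_eq.le
    rcases hhigh with hhigh | ⟨s, hs, hxs, hsmin⟩
    · obtain ⟨y, h1, h2, h3, h4⟩ := hB.exists_kind_gt (a := r.2) hxE (minLevel_comm l x r.1 ▸ hmE r.1)
        hlr (minLevel_le_right l r.1 x) (IsFirst l x) hnf
      exact Or.inl ⟨y, good y h2 h4, fun q hq => fromLow y r hr hrmax hrx
        (compatPairs_of_lt hrx h1 h3.symm) q hq (hhigh q hq)⟩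
    have hrs := (hpp r hr s hs).lt_iff.1 (hrx.trans hxs)
    have hmin := minLevel_eq_min (l := l) hrx.le hxs.le
    rw [(hpp r hr s hs).minLevel_eq] at hmin
    have fin : ∀ y, k y = l x → (l x ∈ L' → (IsFirst k y ↔ IsFirst l x)) → r.2 < y → y < s.2 →
        minLevel k r.2 y = minLevel l r.1 x → minLevel k y s.2 = minLevel l x s.1 →
        ∃ y, GoodPair l k (L ∩ L') (x, y) ∧ ∀ q ∈ p, CompatPairs l k q (x, y) := by
      intro y h1 h2 h3 h4 h5 h6
      refine ⟨y, good y h1 h2, fun q hq => ?_⟩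
      rcases hcases q hq with h | h
      · exact fromLow y r hr hrmax hrx (compatPairs_of_lt hrx h3 h5.symm) q hq h
      · exact fromHigh y s hs hsmin hxs (compatPairs_of_lt hxs h4 h6.symm) q hq h
    -- The smaller of the two separation levels is that of `r` and `s`. It suffices to realize the
    -- larger one by going away from the neighbour on that side; the other is then forced. Only when
    -- the larger one is on the right, so that `y` is sought just below `s.2`, can `s.2` be first
    -- and block the way.
    rcases lt_trichotomy (minLevel l r.1 x) (minLevel l x s.1) with hlt | heq | hgt
    · rw [min_eq_left hlt.le] at hmin
      rcases hB.exists_kind_lt (b := s.2) hxE (hmE s.1)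
        ((minLevel_le_right l x s.1).trans (hp s hs).level_eq.le) (minLevel_le_left l x s.1)
        (IsFirst l x) with ⟨y, h1, h2, h3, h4⟩ | ⟨h1, h2⟩
      · have hry : r.2 < y := by
          by_contra! hyr
          have h5 : minLevel k y s.2 ≤ minLevel k r.2 s.2 :=
            minLevel_anti (uIcc_subset_uIcc_right (mem_uIcc_of_le' hyr hrs.le))
          rw [h3, hmin] at h5
          exact absurd h5 (not_le.2 hlt)
        refine Or.inl (fin y h2 h4 hry h1 ?_ h3)
        have h5 := minLevel_eq_min (l := k) hry.le h1.le
        rw [hmin, h3] at h5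
        rcases min_choice (minLevel k r.2 y) (minLevel l x s.1) with h6 | h6
        · rw [h5, h6]
        · exact absurd (h5.trans h6) hlt.ne
      · rw [← (hp s hs).level_eq] at h2
        refine Or.inr ⟨s, hs, hxs, h1, h2.symm, fun hL => ?_⟩
        have hL' : l s.1 ∈ L' := (hp s hs).level_eq ▸ hB.mem_of_isFirst h1
        exact not_isFirst hxs h2.le (((hp s hs).first_iff ⟨hL, hL'⟩).2 h1)
    · rw [← heq, min_self] at hmin
      obtain ⟨y, h1, h2, h3, h4, h5, h6⟩ := hB.exists_kind_Ioo hxE hrs hmin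
        (minLevel_le_right l r.1 x) (IsFirst l x) hnf
      exact Or.inl (fin y h3 h6 h1 h2 h4 (h5.trans heq))
    · rw [min_eq_right hgt.le] at hmin
      obtain ⟨y, h1, h2, h3, h4⟩ := hB.exists_kind_gt (a := r.2) hxE (minLevel_comm l x r.1 ▸ hmE r.1)
        hlr (minLevel_le_right l r.1 x) (IsFirst l x) hnf
      have hys : y < s.2 := by
        by_contra! hsy
        have h5 : minLevel k r.2 y ≤ minLevel k r.2 s.2 :=
          minLevel_anti (uIcc_subset_uIcc_left (mem_uIcc_of_le' hrs.le hsy))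
        rw [h3, hmin] at h5
        exact absurd h5 (not_le.2 hgt)
      refine Or.inl (fin y h2 h4 h1 hys h3 ?_)
      have h5 := minLevel_eq_min (l := k) h1.le hys.le
      rw [hmin, h3] at h5
      rcases min_choice (minLevel l r.1 x) (minLevel k y s.2) with h6 | h6
      · exact absurd (h5.trans h6) hgt.ne
      · rw [h5, h6]

end Compat

/-! ### Transfer of compatibility to nearby pairs -/

section Amalgamation

variable {A B ι : Type*} [LinearOrder A] [LinearOrder B] [LinearOrder ι] [WellFoundedLT ι]
  {l : A → ι} {k : B → ι}

theorem lt_of_le_minLevel {x y z : A} {δ : ι} (h : δ ≤ minLevel l y z) (hx : l x < δ) (hxy : x < y) :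
    x < z := by
  by_contra! hzx
  have := minLevel_le_of_mem (l := l) (mem_uIcc_of_le' hzx hxy.le)
  rw [minLevel_comm] at this
  exact absurd (h.trans this) (not_le.2 hx)

theorem gt_of_le_minLevel {x y z : A} {δ : ι} (h : δ ≤ minLevel l y z) (hx : l x < δ) (hxy : y < x) :
    z < x := by
  by_contra! hzx
  exact absurd (h.trans (minLevel_le_of_mem (l := l) (mem_uIcc_of_le' hxy.le hzx))) (not_le.2 hx)

theorem minLevel_le_of_le_minLevel {x y z : A} {δ : ι} (h : δ ≤ minLevel l y z) (hx : l x < δ) :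
    minLevel l x y ≤ minLevel l x z := by
  refine le_trans (le_min le_rfl ?_) (min_minLevel_le l x y z)
  exact ((minLevel_le_left l x y).trans hx.le).trans h

/-- Compatibility with a pair is inherited by pairs that are separated from it only on higher
levels. -/
theorem CompatPairs.of_le_minLevel {q r r' : A × B} {δ : ι} (h : CompatPairs l k q r)
    (hl : l q.1 < δ) (hk : k q.2 < δ) (hlr : δ ≤ minLevel l r.1 r'.1)
    (hkr : δ ≤ minLevel k r.2 r'.2) : CompatPairs l k q r' := by
  have hlr' := hlr
  have hkr' := hkr
  rw [minLevel_comm] at hlr' hkr'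
  have e1 : q.1 < r'.1 ↔ q.1 < r.1 := ⟨lt_of_le_minLevel hlr' hl, lt_of_le_minLevel hlr hl⟩
  have e2 : q.2 < r'.2 ↔ q.2 < r.2 := ⟨lt_of_le_minLevel hkr' hk, lt_of_le_minLevel hkr hk⟩
  have e3 : r'.1 < q.1 ↔ r.1 < q.1 := ⟨gt_of_le_minLevel hlr' hl, gt_of_le_minLevel hlr hl⟩
  have e4 : r'.2 < q.2 ↔ r.2 < q.2 := ⟨gt_of_le_minLevel hkr' hk, gt_of_le_minLevel hkr hk⟩
  refine ⟨by rw [e1, e2, h.lt_iff], by rw [e3, e4, h.gt_iff], ?_⟩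
  rw [le_antisymm (minLevel_le_of_le_minLevel hlr' hl) (minLevel_le_of_le_minLevel hlr hl),
    le_antisymm (minLevel_le_of_le_minLevel hkr' hk) (minLevel_le_of_le_minLevel hkr hk),
    h.minLevel_eq]

/-- If `r'` lies beyond `r`, the new separation level is the minimum of two known ones. If `r'` lies
between the separating point and `r`, that point already attains the least level of the shorter
interval. -/
theorem CompatPairs.of_separated_lt {q r r' : A × B} {c : A} {d : B} (h : CompatPairs l k q r)
    (h' : CompatPairs l k r r') (hqc : q.1 ≤ c) (hcr : c ≤ r.1) (hcr' : c < r'.1)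
    (hqd : q.2 ≤ d) (hdr : d ≤ r.2) (hdr' : d < r'.2) (hc : l c = minLevel l q.1 r.1)
    (hd : k d = minLevel k q.2 r.2) : CompatPairs l k q r' := by
  refine compatPairs_of_lt (hqc.trans_lt hcr') (hqd.trans_lt hdr') ?_
  rcases le_total r.1 r'.1 with h1 | h1
  · rw [minLevel_eq_min (hqc.trans hcr) h1, minLevel_eq_min (hqd.trans hdr) (h'.le_iff.1 h1),
      h.minLevel_eq, h'.minLevel_eq]
  · have h2 := h'.symm.le_iff.1 h1
    have e1 : minLevel l q.1 r'.1 = minLevel l q.1 r.1 :=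
      le_antisymm ((minLevel_le_of_mem (mem_uIcc_of_le' hqc hcr'.le)).trans hc.le)
        (minLevel_anti (uIcc_subset_uIcc_left (mem_uIcc_of_le' (hqc.trans hcr'.le) h1)))
    have e2 : minLevel k q.2 r'.2 = minLevel k q.2 r.2 :=
      le_antisymm ((minLevel_le_of_mem (mem_uIcc_of_le' hqd hdr'.le)).trans hd.le)
        (minLevel_anti (uIcc_subset_uIcc_left (mem_uIcc_of_le' (hqd.trans hdr'.le) h2)))
    rw [e1, e2, h.minLevel_eq]

theorem CompatPairs.of_separated_gt {q r r' : A × B} {c : A} {d : B} (h : CompatPairs l k q r)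
    (h' : CompatPairs l k r r') (hqc : c ≤ q.1) (hcr : r.1 ≤ c) (hcr' : r'.1 < c)
    (hqd : d ≤ q.2) (hdr : r.2 ≤ d) (hdr' : r'.2 < d) (hc : l c = minLevel l q.1 r.1)
    (hd : k d = minLevel k q.2 r.2) : CompatPairs l k q r' := by
  refine (compatPairs_of_lt (q := r') (r := q) (hcr'.trans_le hqc) (hdr'.trans_le hqd) ?_).symm
  rw [minLevel_comm l] at hc
  rw [minLevel_comm k] at hd
  rcases le_total r'.1 r.1 with h1 | h1
  · rw [minLevel_eq_min h1 (hcr.trans hqc), minLevel_eq_min (h'.symm.le_iff.1 h1) (hdr.trans hqd),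
      h.symm.minLevel_eq, h'.symm.minLevel_eq]
  · have h2 := h'.le_iff.1 h1
    have e1 : minLevel l r'.1 q.1 = minLevel l r.1 q.1 :=
      le_antisymm ((minLevel_le_of_mem (mem_uIcc_of_le' hcr'.le hqc)).trans hc.le)
        (minLevel_anti (uIcc_subset_uIcc_right (mem_uIcc_of_le' h1 (hcr'.le.trans hqc))))
    have e2 : minLevel k r'.2 q.2 = minLevel k r.2 q.2 :=
      le_antisymm ((minLevel_le_of_mem (mem_uIcc_of_le' hdr'.le hqd)).trans hd.le)
        (minLevel_anti (uIcc_subset_uIcc_right (mem_uIcc_of_le' h2 (hdr'.le.trans hqd))))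
    rw [e1, e2, h.symm.minLevel_eq]

end Amalgamation

/-- Chains of `A × B` on which pairs of points of equal levels are separated on equal levels. -/
def IsCoherent {A B ι : Type*} [LinearOrder A] [LinearOrder B] [LinearOrder ι] [WellFoundedLT ι]
    (l : A → ι) (k : B → ι) (K : ℕ → Set (A × B)) : Prop :=
  ∀ n, ∀ q ∈ K n, ∀ r ∈ K n, l q.1 = k q.2 → l r.1 = k r.2 →
    minLevel l q.1 r.1 = minLevel k q.2 r.2

/-- Finite partial isomorphisms, ordered by reverse inclusion. -/
structure PartialIso {A B : Type u} {ι : Type v} [LinearOrder A] [LinearOrder B] [LinearOrder ι]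
    [WellFoundedLT ι] (l : A → ι) (k : B → ι) (M : Set ι) where
  carrier : Finset (A × B)
  good : ∀ q ∈ carrier, GoodPair l k M q
  compat : ∀ q ∈ carrier, ∀ r ∈ carrier, CompatPairs l k q r

namespace PartialIso

section

variable {A B : Type u} {ι : Type v} [LinearOrder A] [LinearOrder B] [LinearOrder ι]
  [WellFoundedLT ι] {l : A → ι} {k : B → ι} {M : Set ι}

instance : Preorder (PartialIso l k M) where
  le p q := q.carrier ⊆ p.carrier
  le_refl p := Finset.Subset.refl _
  le_trans p q r h h' := Finset.Subset.trans h' h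

instance : Nonempty (PartialIso l k M) := ⟨⟨∅, by simp, by simp⟩⟩

theorem carrier_injective : Function.Injective (carrier : PartialIso l k M → _) := by
  rintro ⟨p, _, _⟩ ⟨q, _, _⟩ h
  cases h
  rfl

theorem compatible_of_forall {p q : PartialIso l k M}
    (h : ∀ x ∈ p.carrier, ∀ y ∈ q.carrier, CompatPairs l k x y) : Compatible p q := by
  classical
  refine ⟨⟨p.carrier ∪ q.carrier, ?_, ?_⟩, Finset.subset_union_left, Finset.subset_union_right⟩
  · intro x hx
    rcases Finset.mem_union.1 hx with hx | hx
    · exact p.good x hx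
    · exact q.good x hx
  · intro x hx y hy
    rcases Finset.mem_union.1 hx with hx | hx <;> rcases Finset.mem_union.1 hy with hy | hy
    · exact p.compat x hx y hy
    · exact h x hx y hy
    · exact (h y hy x hx).symm
    · exact q.compat x hx y hy

theorem exists_insert (p : PartialIso l k M) {x : A × B} (hx : GoodPair l k M x)
    (h : ∀ q ∈ p.carrier, CompatPairs l k q x) : ∃ q ≤ p, x ∈ q.carrier := by
  classical
  refine ⟨⟨insert x p.carrier, ?_, ?_⟩, Finset.subset_insert _ _, Finset.mem_insert_self _ _⟩
  · intro y hy
    rcases Finset.mem_insert.1 hy with rfl | hy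
    · exact hx
    · exact p.good y hy
  · intro y hy z hz
    rcases Finset.mem_insert.1 hy with hy | hy <;> rcases Finset.mem_insert.1 hz with hz | hz
    · rw [hy, hz]
      exact hx.compatPairs_self
    · rw [hy]
      exact (h z hz).symm
    · rw [hz]
      exact h y hy
    · exact p.compat y hy z hz

end

variable {A B : Type u} [LinearOrder A] [LinearOrder B] {l : A → OmegaOne} {k : B → OmegaOne}
  {M : Set OmegaOne} {K : ℕ → Set (A × B)}

/-- A finite description of an enumerated condition, with parameters of level below `ζ`. -/
structure Code (l : A → OmegaOne) (k : B → OmegaOne) (ζ : OmegaOne) where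
  size : ℕ
  data : (Fin size → ℕ × Option ({a // l a < ζ} × {b // k b < ζ})) ×
    (Fin size → Fin size → Bool × Option ({a // l a < ζ} × {b // k b < ζ}))

omit [LinearOrder A] [LinearOrder B] in
theorem countable_code (ζ : OmegaOne) (hl : {a | l a < ζ}.Countable)
    (hk : {b | k b < ζ}.Countable) : Countable (Code l k ζ) := by
  have : Countable {a // l a < ζ} := hl.to_subtype
  have : Countable {b // k b < ζ} := hk.to_subtype
  have hinj : Function.Injective (fun c : Code l k ζ => (⟨c.size, c.data⟩ :
      Σ n : ℕ, (Fin n → ℕ × Option ({a // l a < ζ} × {b // k b < ζ})) ×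
        (Fin n → Fin n → Bool × Option ({a // l a < ζ} × {b // k b < ζ})))) := by
    rintro ⟨n, d⟩ ⟨m, e⟩ h
    cases h
    rfl
  exact hinj.countable

/-- The enumeration `e` of a condition has the description `c` relative to `δ`. -/
structure Realizes {ζ : OmegaOne} (K : ℕ → Set (A × B)) (c : Code l k ζ) (δ : OmegaOne)
    (e : Fin c.size → A × B) : Prop where
  chain : ∀ i, e i ∈ K (c.data.1 i).1
  root : ∀ i q, (c.data.1 i).2 = some q → e i = (q.1.1, q.2.1)
  le_level : ∀ i, (c.data.1 i).2 = none → δ ≤ l (e i).1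
  order : ∀ i j, (c.data.2 i j).1 = true ↔ (e i).1 < (e j).1
  le_minLevel : ∀ i j, (c.data.2 i j).2 = none → δ ≤ minLevel l (e i).1 (e j).1
  separated : ∀ i j q, (c.data.2 i j).2 = some q →
    l q.1.1 = minLevel l (e i).1 (e j).1 ∧ k q.2.1 = minLevel k (e i).2 (e j).2 ∧
      l q.1.1 < δ ∧ q.1.1 ∈ uIcc (e i).1 (e j).1 ∧ q.2.1 ∈ uIcc (e i).2 (e j).2

/-- Different levels force both coordinates to differ, so the weak comparison given by the chain is
strict in both. -/
theorem compatPairs_of_chain (hK : IsChainCover K) (hcoh : IsCoherent l k K) {n : ℕ} {q r : A × B}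
    (hq : q ∈ K n) (hr : r ∈ K n) (hlq : l q.1 = k q.2) (hlr : l r.1 = k r.2)
    (hne : l q.1 ≠ l r.1) : CompatPairs l k q r := by
  have h1 : q.1 ≠ r.1 := fun h => hne (h ▸ rfl)
  have h2 : q.2 ≠ r.2 := fun h => hne (by rw [hlq, hlr, h])
  rcases (hK.1 n).total hq hr with h | h
  · exact compatPairs_of_lt (lt_of_le_of_ne h.1 h1) (lt_of_le_of_ne h.2 h2) (hcoh n q hq r hr hlq hlr)
  · exact (compatPairs_of_lt (lt_of_le_of_ne h.1 h1.symm) (lt_of_le_of_ne h.2 h2.symm)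
      (hcoh n r hr q hq hlr hlq)).symm

/-- Root entries coincide. For other entries, `e i` and `e' i` are compatible since they lie in one
chain on different levels. Passing from `e' i` to `e' j` is harmless if these two are separated only
above all levels of `p`. Otherwise both `e i, e j` and `e' i, e' j` are separated by the same coded
points, and the step goes from `e j` to `e' j`. -/
theorem compatible_of_realizes (hK : IsChainCover K) (hcoh : IsCoherent l k K) {ζ : OmegaOne}
    (c : Code l k ζ) {δ δ' : OmegaOne} {e e' : Fin c.size → A × B} {p p' : PartialIso l k M}
    (he : Realizes K c δ e) (he' : Realizes K c δ' e') (hp : ∀ q, q ∈ p.carrier ↔ q ∈ range e)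
    (hp' : ∀ q, q ∈ p'.carrier ↔ q ∈ range e') (hδ : ∀ q ∈ p.carrier, l q.1 < δ') :
    Compatible p p' := by
  have hpe : ∀ i, e i ∈ p.carrier := fun i => (hp _).2 ⟨i, rfl⟩
  have hpe' : ∀ i, e' i ∈ p'.carrier := fun i => (hp' _).2 ⟨i, rfl⟩
  refine compatible_of_forall fun q hq q' hq' => ?_
  obtain ⟨i, rfl⟩ := (hp q).1 hq
  obtain ⟨j, rfl⟩ := (hp' q').1 hq'
  rcases hri : (c.data.1 i).2 with _ | r
  swap
  · rw [he.root i r hri, ← he'.root i r hri]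
    exact p'.compat _ (hpe' i) _ (hpe' j)
  rcases hrj : (c.data.1 j).2 with _ | r
  swap
  · rw [he'.root j r hrj, ← he.root j r hrj]
    exact p.compat _ (hpe i) _ (hpe j)
  have hlev : ∀ i, l (e i).1 = k (e i).2 := fun i => (p.good _ (hpe i)).level_eq
  have hlev' : ∀ i, l (e' i).1 = k (e' i).2 := fun i => (p'.good _ (hpe' i)).level_eq
  have hch : ∀ i, (c.data.1 i).2 = none → CompatPairs l k (e i) (e' i) := fun i hi =>
    compatPairs_of_chain hK hcoh (he.chain i) (he'.chain i) (hlev i) (hlev' i)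
      ((hδ _ (hpe i)).trans_le (he'.le_level i hi)).ne
  rcases hs : (c.data.2 i j).2 with _ | r
  · have h1 := he'.le_minLevel i j hs
    refine (hch i hri).of_le_minLevel (hδ _ hq) (hlev i ▸ hδ _ hq) h1 ?_
    rwa [← (p'.compat _ (hpe' i) _ (hpe' j)).minLevel_eq]
  · obtain ⟨h1, h2, -, h4, h5⟩ := he.separated i j r hs
    obtain ⟨h1', h2', h3', h4', h5'⟩ := he'.separated i j r hs
    have hne : r.1.1 ≠ (e' j).1 := fun h =>
      absurd (h ▸ h3') (not_lt.2 (he'.le_level j hrj))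
    have hkl : k r.2.1 = l r.1.1 := by
      rw [h1', h2', (p'.compat _ (hpe' i) _ (hpe' j)).minLevel_eq]
    have hne2 : r.2.1 ≠ (e' j).2 := fun h => by
      have h6 := he'.le_level j hrj
      rw [hlev' j, ← h, hkl] at h6
      exact absurd h3' (not_lt.2 h6)
    have hc := p.compat _ (hpe i) _ (hpe j)
    have hc' := p'.compat _ (hpe' i) _ (hpe' j)
    by_cases ho : (c.data.2 i j).1 = true
    · have o1 := (he.order i j).1 ho
      have o2 := hc.lt_iff.1 o1
      have o3 := (he'.order i j).1 ho
      have o4 := hc'.lt_iff.1 o3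
      rw [uIcc_of_le o1.le] at h4
      rw [uIcc_of_le o2.le] at h5
      rw [uIcc_of_le o3.le] at h4'
      rw [uIcc_of_le o4.le] at h5'
      exact hc.of_separated_lt (hch j hrj) h4.1 h4.2 (lt_of_le_of_ne h4'.2 hne) h5.1 h5.2
        (lt_of_le_of_ne h5'.2 hne2) h1 h2
    · have o1 := not_lt.1 fun h => ho ((he.order i j).2 h)
      have o2 := hc.symm.le_iff.1 o1
      have o3 := not_lt.1 fun h => ho ((he'.order i j).2 h)
      have o4 := hc'.symm.le_iff.1 o3
      rw [uIcc_of_ge o1] at h4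
      rw [uIcc_of_ge o2] at h5
      rw [uIcc_of_ge o3] at h4'
      rw [uIcc_of_ge o4] at h5'
      exact hc.of_separated_gt (hch j hrj) h4.2 h4.1 (lt_of_le_of_ne h4'.1 hne.symm) h5.2 h5.1
        (lt_of_le_of_ne h5'.1 hne2.symm) h1 h2

theorem exists_bound_below {δ : OmegaOne} (h0 : ⊥ < δ) (s : OmegaOne → OmegaOne)
    (hs : ∀ η, η < s η) (hδ : ∀ η < δ, s η < δ) {α : Type*} [Fintype α] (f : α → OmegaOne) :
    ∃ ζ < δ, ∀ i, f i < δ → f i < ζ := by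
  classical
  -- Values not below `δ` are replaced by `⊥`, so that the finite supremum, and hence its image
  -- under `s`, stays below `δ`.
  refine ⟨s (Finset.univ.sup fun i => if f i < δ then f i else ⊥), hδ _ ?_, fun i hi => ?_⟩
  · rw [Finset.sup_lt_iff h0]
    intro i _
    split_ifs with h
    · exact h
    · exact h0
  · refine lt_of_le_of_lt ?_ (hs _)
    have := Finset.le_sup (f := fun i => if f i < δ then f i else ⊥) (Finset.mem_univ i)
    simpa [hi] using this

theorem exists_realizes (hK : IsChainCover K) {δ ζ : OmegaOne} (p : PartialIso l k M)
    (hζ1 : ∀ q ∈ p.carrier, l q.1 < δ → l q.1 < ζ) (hζδ : ζ < δ)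
    (hζ2 : ∀ q ∈ p.carrier, ∀ r ∈ p.carrier, minLevel l q.1 r.1 < δ → minLevel l q.1 r.1 < ζ) :
    ∃ (c : Code l k ζ) (e : Fin c.size → A × B), Realizes K c δ e ∧
      ∀ q, q ∈ p.carrier ↔ q ∈ range e := by
  classical
  let e : Fin p.carrier.card → A × B := fun i => (p.carrier.equivFin.symm i).1
  have hpe : ∀ i, e i ∈ p.carrier := fun i => (p.carrier.equivFin.symm i).2
  have hlev : ∀ i, l (e i).1 = k (e i).2 := fun i => (p.good _ (hpe i)).level_eq
  have hml : ∀ i j, minLevel l (e i).1 (e j).1 = minLevel k (e i).2 (e j).2 := fun i j =>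
    (p.compat _ (hpe i) _ (hpe j)).minLevel_eq
  choose m hm using fun i => hK.2 (e i)
  choose c hc hlc using fun i j => exists_level_eq_minLevel l (e i).1 (e j).1
  choose d hd hkd using fun i j => exists_level_eq_minLevel k (e i).2 (e j).2
  refine ⟨⟨p.carrier.card,
    fun i => (m i, if h : l (e i).1 < ζ then some (⟨_, h⟩, ⟨(e i).2, hlev i ▸ h⟩) else none),
    fun i j => (decide ((e i).1 < (e j).1), if h : minLevel l (e i).1 (e j).1 < ζ then
      some (⟨c i j, by rwa [hlc]⟩, ⟨d i j, by rwa [hkd, ← hml]⟩) else none)⟩, e,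
    ⟨hm, ?_, ?_, ?_, ?_, ?_⟩, ?_⟩
  · intro i q h
    simp only [Option.dite_none_right_eq_some, Option.some.injEq] at h
    obtain ⟨-, rfl⟩ := h
    rfl
  · intro i h
    simp only [dite_eq_right_iff, reduceCtorEq, imp_false] at h
    by_contra! h1
    exact h (hζ1 _ (hpe i) h1)
  · intro i j
    simp
  · intro i j h
    simp only [dite_eq_right_iff, reduceCtorEq, imp_false] at h
    by_contra! h1
    exact h (hζ2 _ (hpe i) _ (hpe j) h1)
  · intro i j q h
    simp only [Option.dite_none_right_eq_some, Option.some.injEq] at h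
    obtain ⟨h1, rfl⟩ := h
    exact ⟨hlc i j, hkd i j, (hlc i j).trans_lt (h1.trans hζδ), hc i j, hd i j⟩
  · intro q
    refine ⟨fun h => ⟨p.carrier.equivFin ⟨q, h⟩, by simp [e]⟩, ?_⟩
    rintro ⟨i, rfl⟩
    exact hpe i

/-- A reflection argument: there are only countably many codes over a given `ζ`, so some `δ` lies
above all bounds of the boundedly realized codes over any `ζ < δ`. A condition in `W` with a level
at least `δ` has a code over some `ζ < δ`, which is therefore realized unboundedly often. A
realization beyond all levels of the condition is a different compatible member of `W`. -/
theorem isCCC (hK : IsChainCover K) (hcoh : IsCoherent l k K)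
    (hl : ∀ ξ, {a | l a < ξ}.Countable) (hk : ∀ ξ, {b | k b < ξ}.Countable) :
    IsCCC (PartialIso l k M) := by
  classical
  intro W hW
  by_contra hunc
  let R : ∀ {ζ : OmegaOne}, Code l k ζ → OmegaOne → Prop := fun {ζ} c δ =>
    ∃ p ∈ W, ∃ e : Fin c.size → A × B, Realizes K c δ e ∧ ∀ q, q ∈ p.carrier ↔ q ∈ range e
  have hβ : ∀ {ζ : OmegaOne} (c : Code l k ζ), ∃ β, (∀ δ, ∃ δ' > δ, R c δ') ∨ ∀ δ > β, ¬ R c δ := by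
    intro ζ c
    by_cases h : ∀ δ, ∃ δ' > δ, R c δ'
    · exact ⟨⊥, Or.inl h⟩
    · push Not at h
      obtain ⟨β, hβ⟩ := h
      exact ⟨β, Or.inr hβ⟩
  choose β hβ using fun ζ => @hβ ζ
  have hF : ∀ ζ, ∃ F, ∀ c : Code l k ζ, β ζ c < F := fun ζ =>
    have := countable_code ζ (hl ζ) (hk ζ)
    OmegaOne.exists_forall_lt (β ζ)
  choose F hF using hF
  choose s hs using fun ξ : OmegaOne => exists_gt ξ
  obtain ⟨δ, hδ, hpos⟩ := OmegaOne.exists_closedPoint_gt (fun η => max (F η) (s η)) ⊥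
  -- Only countably many conditions have all their points on levels below `δ`.
  have hbig : ∃ p ∈ W, ∃ q ∈ p.carrier, δ ≤ l q.1 := by
    by_contra! h
    refine hunc ?_
    have h1 : {q : A × B | l q.1 < δ ∧ k q.2 < δ}.Countable := (hl δ).prod (hk δ)
    have h2 : {t : Set (A × B) | t.Finite ∧ t ⊆ {q : A × B | l q.1 < δ ∧ k q.2 < δ}}.Countable :=
      Set.countable_ofPred_finite_subset h1
    refine (h2.preimage (f := fun p : PartialIso l k M => (p.carrier : Set (A × B)))
      (fun p q hpq => carrier_injective (Finset.coe_injective hpq))).mono ?_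
    intro p hp
    refine ⟨p.carrier.finite_toSet, fun q hq => ⟨h p hp q hq, ?_⟩⟩
    rw [← (p.good q hq).level_eq]
    exact h p hp q hq
  obtain ⟨p, hpW, q, hq, hqδ⟩ := hbig
  obtain ⟨ζ1, hζ1, h1⟩ := exists_bound_below hpos s hs
    (fun η hη => (le_max_right _ _).trans_lt (hδ η hη)) (fun q : p.carrier => l q.1.1)
  obtain ⟨ζ2, hζ2, h2⟩ := exists_bound_below hpos s hs
    (fun η hη => (le_max_right _ _).trans_lt (hδ η hη))
    (fun q : p.carrier × p.carrier => minLevel l q.1.1.1 q.2.1.1)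
  obtain ⟨c, e, he, hpe⟩ := exists_realizes hK (δ := δ) (ζ := max ζ1 ζ2) p
    (fun q hq h => (h1 ⟨q, hq⟩ h).trans_le (le_max_left _ _)) (max_lt hζ1 hζ2)
    (fun q hq r hr h => (h2 (⟨q, hq⟩, ⟨r, hr⟩) h).trans_le (le_max_right _ _))
  have hunb : ∀ δ, ∃ δ' > δ, R c δ' := by
    refine (hβ _ c).resolve_right fun h => h δ ?_ ⟨p, hpW, e, he, hpe⟩
    exact (hF _ c).trans ((le_max_left _ _).trans_lt (hδ _ (max_lt hζ1 hζ2)))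
  obtain ⟨γ, hγ⟩ := OmegaOne.exists_forall_lt (fun q : p.carrier => l q.1.1)
  obtain ⟨δ', hδ', p', hp'W, e', he', hpe'⟩ := hunb γ
  have hlow : ∀ q ∈ p.carrier, l q.1 < δ' := fun q hq => (hγ ⟨q, hq⟩).trans hδ'
  -- The entry of level at least `δ` is not a root entry, so in the second realization it has level
  -- at least `δ'`, above every level of `p`.
  have hne : p ≠ p' := by
    rintro rfl
    obtain ⟨i, rfl⟩ := (hpe q).1 hq
    have hnone : (c.data.1 i).2 = none := by
      rw [Option.eq_none_iff_forall_ne_some]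
      intro r hr
      have h3 := he.root i r hr
      rw [h3] at hqδ
      exact absurd (r.1.2.trans (max_lt hζ1 hζ2)) (not_lt.2 hqδ)
    exact absurd (hlow _ ((hpe' _).2 ⟨i, rfl⟩)) (not_lt.2 (he'.le_level i hnone))
  exact hW hpW hp'W hne (compatible_of_realizes hK hcoh c he he' hpe hpe' hlow)

end PartialIso

/-- A filter meeting the dense sets yields an isomorphism from a subset of `A` onto `B`; each `x` is
sent to the image of the least domain point on or above `x`. The inclusion `L ⊆ L'` excludes the
exceptional case of `exists_extension` when points of `B` are added. -/
theorem exists_epimorphism_of_isLevelled (hMA : MartinAxiomAlephOne.{u}) {A B : Type u}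
    [LinearOrder A] [LinearOrder B] {l : A → OmegaOne} {k : B → OmegaOne} {E L L' : Set OmegaOne}
    {K : ℕ → Set (A × B)} (hA : IsLevelled l E L) (hB : IsLevelled k E L') (hLL : L ⊆ L')
    (hK : IsChainCover K) (hcoh : IsCoherent l k K) (hcA : #A ≤ ℵ₁) (hcB : #B ≤ ℵ₁) :
    ∃ f : A → B, Monotone f ∧ Function.Surjective f := by
  classical
  let P := PartialIso l k (L ∩ L')
  -- Either `x` is in the domain, or it is already bound to be collapsed to a first point of `B`.
  let DA : A → Set P := fun x => {p | ∃ q ∈ p.carrier, q.1 = x ∨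
    (x < q.1 ∧ IsFirst k q.2 ∧ minLevel l x q.1 = l q.1)}
  let DB : B → Set P := fun y => {p | ∃ q ∈ p.carrier, q.2 = y}
  have hex : ∃ G : Order.PFilter P, ∀ E ∈ range DA ∪ range DB, ((G : Set P) ∩ E).Nonempty := by
    refine hMA P (PartialIso.isCCC hK hcoh hA.countable hB.countable) _ ?_ ?_
    · refine (Cardinal.mk_union_le _ _).trans ?_
      refine Cardinal.add_le_of_le (Cardinal.aleph0_le_aleph 1) ?_ ?_
      · exact Cardinal.mk_range_le.trans hcA
      · exact Cardinal.mk_range_le.trans hcB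
    · rintro _ (⟨x, rfl⟩ | ⟨y, rfl⟩) p
      · rcases exists_extension hA hB p.carrier p.good p.compat x with ⟨y, h1, h2⟩ | ⟨q, hq, h1, h2, h3, -⟩
        · obtain ⟨p', hp', h3⟩ := p.exists_insert h1 h2
          exact ⟨p', ⟨_, h3, Or.inl rfl⟩, hp'⟩
        · exact ⟨p, ⟨q, hq, Or.inr ⟨h1, h2, h3⟩⟩, le_rfl⟩
      · have hsw : ∀ q ∈ p.carrier.image Prod.swap, q.swap ∈ p.carrier := by
          intro q hq
          obtain ⟨r, hr, rfl⟩ := Finset.mem_image.1 hq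
          exact hr
        rcases exists_extension hB hA (p.carrier.image Prod.swap)
          (fun q hq => inter_comm L L' ▸ (p.good _ (hsw q hq)).swap)
          (fun q hq r hr => (p.compat _ (hsw q hq) _ (hsw r hr)).swap) y
          with ⟨x, h1, h2⟩ | ⟨q, hq, -, h2, -, h4⟩
        · obtain ⟨p', hp', h3⟩ := p.exists_insert (x := (x, y)) (inter_comm L L' ▸ h1.swap) (fun q hq =>
            (h2 q.swap (Finset.mem_image_of_mem _ hq)).swap)
          exact ⟨p', ⟨_, h3, rfl⟩, hp'⟩
        · refine absurd (hLL ?_) h4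
          have h5 := (p.good _ (hsw q hq)).level_eq
          have h6 := hA.mem_of_isFirst h2
          have h7 : l q.2 = k q.1 := h5
          rwa [h7] at h6
  obtain ⟨G, hG⟩ := hex
  have hdir : ∀ p ∈ G, ∀ p' ∈ G, ∀ q ∈ p.carrier, ∀ q' ∈ p'.carrier, CompatPairs l k q q' := by
    intro p hp p' hp' q hq q' hq'
    obtain ⟨r, -, h1, h2⟩ := G.directed p hp p' hp'
    exact r.compat q (h1 hq) q' (h2 hq')
  have hex : ∀ x, ∃ q : A × B, (∃ p ∈ G, q ∈ p.carrier) ∧ x ≤ q.1 ∧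
      ∀ r, (∃ p ∈ G, r ∈ p.carrier) → x ≤ r.1 → q.1 ≤ r.1 := by
    intro x
    obtain ⟨p, hpG, q, hq, h⟩ := hG (DA x) (Or.inl ⟨x, rfl⟩)
    refine ⟨q, ⟨p, hpG, hq⟩, ?_, ?_⟩
    · rcases h with h | h
      · exact h.ge
      · exact h.1.le
    · rintro r ⟨p', hp', hr⟩ hxr
      rcases h with rfl | ⟨-, h2, h3⟩
      · exact hxr
      -- A domain point `r` with `x ≤ r.1 < q.1` would be mapped strictly below `q.2` into its
      -- class, of which `q.2` is the first point.
      by_contra! hrq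
      have hc := hdir p' hp' p hpG r hr q hq
      have h4 : minLevel l x q.1 ≤ minLevel l r.1 q.1 :=
        minLevel_anti (uIcc_subset_uIcc_right (mem_uIcc_of_le' hxr hrq.le))
      rw [h3, hc.minLevel_eq, (p.good q hq).level_eq] at h4
      exact not_isFirst (hc.lt_iff.1 hrq) h4 h2
  choose g hgG hg1 hg2 using hex
  have hgc : ∀ q r : A × B, (∃ p ∈ G, q ∈ p.carrier) → (∃ p ∈ G, r ∈ p.carrier) →
      CompatPairs l k q r := by
    rintro q r ⟨p, hp, hq⟩ ⟨p', hp', hr⟩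
    exact hdir p hp p' hp' q hq r hr
  refine ⟨fun x => (g x).2, fun x x' hxx => ?_, fun y => ?_⟩
  · exact (hgc _ _ (hgG x) (hgG x')).le_iff.1 (hg2 x _ (hgG x') (hxx.trans (hg1 x')))
  · obtain ⟨p, hpG, q, hq, rfl⟩ := hG (DB y) (Or.inr ⟨y, rfl⟩)
    refine ⟨q.1, (hgc _ _ (hgG q.1) ⟨p, hpG, hq⟩).eq_iff.1 (le_antisymm ?_ (hg1 q.1))⟩
    exact hg2 q.1 q ⟨p, hpG, hq⟩ le_rfl

/-! ### Levels from decompositions -/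

theorem gapClass_eq_of_mem {A : Type u} [LinearOrder A] {X : Set A} {a r : A}
    (h : r ∈ gapClass X a) : gapClass X r = gapClass X a :=
  Set.ext fun _ => ⟨mem_gapClass_trans h, mem_gapClass_trans (mem_gapClass_comm.1 h)⟩

theorem not_countable_of_mk_eq {A : Type u} {s : Set A} (h : #s = ℵ₁) : ¬ s.Countable := by
  rw [← Cardinal.le_aleph0_iff_set_countable, h, not_le]
  exact Cardinal.aleph0_lt_aleph_one

theorem IsAlephOneDense.exists_between_notMem {A : Type u} [LinearOrder A] (h : IsAlephOneDense A)
    {x y : A} (hxy : x < y) {X : Set A} (hX : X.Countable) : ∃ a, x < a ∧ a < y ∧ a ∉ X := by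
  by_contra! h1
  refine not_countable_of_mk_eq (h.2.2.2 x y hxy)
    ((hX.union (Set.toFinite {x, y}).countable).mono fun a ha => ?_)
  rcases ha.1.eq_or_lt with rfl | h2
  · exact Or.inr (by simp)
  rcases ha.2.eq_or_lt with rfl | h3
  · exact Or.inr (by simp)
  exact Or.inl (h1 a h2 h3)

/-- The level of a point is the largest closed point of `Φ` below or equal to its rank. At nonzero
closed points, which are limits, the points of smaller level are exactly the stage `D ξ`, so classes
are complementary intervals. The countable sets `N η` supply the witnesses, whose levels are
controlled by `floor_le_floor`. -/
theorem exists_isLevelled {A : Type u} [LinearOrder A] {D : OmegaOne → Set A}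
    {σ : A → OmegaOne} {Λ : Set OmegaOne} (hC : IsCountryman A) (hdense : IsAlephOneDense A)
    (hD : IsDecomposition D) (hσ : ∀ a ξ, a ∈ D ξ ↔ σ a ≤ ξ)
    (hσl : ∀ a ξ, Order.IsSuccLimit ξ → (a ∈ D ξ ↔ σ a < ξ))
    (hleft : leftSet D = Λ) (hhat : leftHatSet D = Λ) (hright : rightSet D = ∅) :
    ∃ N : OmegaOne → Set A, (∀ η, (N η).Countable) ∧ ∀ Φ : OmegaOne → OmegaOne, (∀ η, η < Φ η) →
      (∀ η, ∀ y ∈ N η, σ y ≤ Φ η) →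
      IsLevelled (fun a => OmegaOne.floor Φ (σ a)) (OmegaOne.closedPoints Φ) (Λ \ {⊥}) := by
  classical
  obtain ⟨K, hK⟩ := hC.exists_isChainCover
  have hne := hC.1
  obtain ⟨-, hnomin, hnomax, -⟩ := id hdense
  -- The ordinal `⊥` is vacuously closed and no level lies below it, whereas `D ⊥` may be nonempty.
  -- With the empty set there, the only class at `⊥` is the whole line, which has no endpoints; this
  -- is why `⊥` is removed from `Λ`.
  let X : OmegaOne → Set A := fun η => if η = ⊥ then ∅ else D η
  have hX0 : X ⊥ = ∅ := by simp [X]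
  have hX1 : ∀ η, η ≠ ⊥ → X η = D η := fun η h => by simp [X, h]
  have hXc : ∀ η, (X η).Countable := by
    intro η
    by_cases h : η = ⊥
    · rw [h, hX0]; exact countable_empty
    · rw [hX1 η h]; exact hD.countable η
  choose Q hQs hQc hQ using fun Y : Set A => hK.exists_countable_cofinal Y
  choose P hPs hPc hP using fun Y : Set A => hK.exists_countable_coinitial Y
  choose R hRc hR using fun η => hK.exists_countable_representatives (hXc η)
  let N : OmegaOne → Set A := fun η => (⋃ x ∈ D η, P (Ioi x) ∪ Q (Iio x)) ∪
    ⋃ r ∈ R η, Q (gapClass (X η) r) ∪ P (gapClass (X η) r)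
  refine ⟨N, fun η => ((hD.countable η).biUnion fun x _ => (hPc _).union (hQc _)).union
    ((hRc η).biUnion fun x _ => (hQc _).union (hPc _)), fun Φ hΦ hN => ?_⟩
  let l : A → OmegaOne := fun a => OmegaOne.floor Φ (σ a)
  change IsLevelled l _ _
  have hXl : ∀ ξ ∈ OmegaOne.closedPoints Φ, ∀ a, a ∈ X ξ ↔ l a < ξ := by
    intro ξ hξ a
    by_cases h : ξ = ⊥
    · subst h; simp [hX0]
    · rw [hX1 ξ h, hσl a ξ (OmegaOne.isSuccLimit_of_mem_closedPoints hΦ hξ h)]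
      exact (OmegaOne.floor_lt_iff hξ).symm
  have hgap : ∀ ξ ∈ OmegaOne.closedPoints Φ, ∀ a y,
      y ∈ gapClass (X ξ) a ↔ ξ ≤ minLevel l a y := by
    intro ξ hξ a y
    rw [le_minLevel]
    refine Set.disjoint_left.trans (forall₂_congr fun c _ => ?_)
    rw [hXl ξ hξ, not_lt]
  have hPl : ∀ x, ∀ z ∈ P (Ioi x), l z ≤ l x := fun x z hz => OmegaOne.floor_le_floor
    (hN _ z (Or.inl (mem_biUnion ((hσ x _).2 le_rfl) (Or.inl hz))))
  have hQl : ∀ x, ∀ z ∈ Q (Iio x), l z ≤ l x := fun x z hz => OmegaOne.floor_le_floor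
    (hN _ z (Or.inl (mem_biUnion ((hσ x _).2 le_rfl) (Or.inr hz))))
  have hcl : ∀ ξ ∈ OmegaOne.closedPoints Φ, ∀ a, ξ ≤ l a → ∀ z,
      z ∈ Q (gapClass (X ξ) a) ∪ P (gapClass (X ξ) a) → l z = ξ := by
    intro ξ hξ a ha z hz
    have haX : a ∉ X ξ := fun h => absurd ((hXl ξ hξ a).1 h) (not_lt.2 ha)
    obtain ⟨r, hr, hra⟩ := hR ξ a haX
    have hzX : z ∉ X ξ := by
      rcases hz with hz | hz
      · exact notMem_of_mem_gapClass (hQs _ hz)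
      · exact notMem_of_mem_gapClass (hPs _ hz)
    refine le_antisymm ?_ (not_lt.1 fun h => hzX ((hXl ξ hξ z).2 h))
    rw [← gapClass_eq_of_mem hra] at hz
    rw [← OmegaOne.floor_eq_self hξ]
    exact OmegaOne.floor_le_floor (hN _ z (Or.inr (mem_biUnion hr hz)))
  have hnotMem : ∀ ξ ∈ OmegaOne.closedPoints Φ, ∀ a, ξ ≤ l a → a ∉ X ξ := fun ξ hξ a ha h =>
    absurd ((hXl ξ hξ a).1 h) (not_lt.2 ha)
  have huniv : ∀ a, gapClass (X ⊥) a = Set.univ := fun a => by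
    rw [hX0]; ext; simp [gapClass]
  have hgt : ∀ a, ∀ ξ ∈ OmegaOne.closedPoints Φ, ξ ≤ l a →
      ∃ c, a < c ∧ l c = ξ ∧ minLevel l a c = ξ := by
    intro a ξ hξ ha
    have haX := hnotMem ξ hξ a ha
    obtain ⟨y, hy, hay⟩ : ∃ y ∈ gapClass (X ξ) a, a < y := by
      by_cases h : ξ = ⊥
      · subst h
        obtain ⟨y, hy⟩ := hnomax.exists_gt a
        exact ⟨y, huniv a ▸ Set.mem_univ y, hy⟩
      by_contra! h1
      have : ξ ∈ rightSet D := ⟨_, hX1 ξ h ▸ isComplementaryInterval_gapClass haX, a,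
        mem_gapClass_self haX, h1⟩
      rw [hright] at this
      exact this
    obtain ⟨c, hc, hyc⟩ := hQ _ y hy
    have hlc := hcl ξ hξ a ha c (Or.inl hc)
    exact ⟨c, hay.trans_le hyc, hlc, le_antisymm ((minLevel_le_right l a c).trans hlc.le)
      ((hgap ξ hξ a c).1 (hQs _ hc))⟩
  refine ⟨fun a => OmegaOne.floor_mem Φ _, fun ξ => ?_, fun x y hxy => ?_, fun x y ξ hξ hxy hx hy => ?_,
    hgt, fun a ξ hξ hL ha => ?_, fun a ξ hξ hL ha => ?_, fun ξ hξ => ?_⟩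
  · obtain ⟨e, he, hξe⟩ := OmegaOne.exists_closedPoint_gt Φ ξ
    exact (hXc e).mono fun a ha => (hXl e he a).2 (lt_trans ha hξe)
  · obtain ⟨y', hxy', hyy', -⟩ := hdense.exists_between_notMem hxy countable_empty
    obtain ⟨c, hc, hlc⟩ := exists_level_eq_minLevel l x y
    rw [uIcc_of_le hxy.le] at hc
    rcases hc.1.eq_or_lt with rfl | hxc
    · obtain ⟨z, hz, hzy⟩ := hP (Ioi x) y' hxy'
      have hxz : x < z := hPs (Ioi x) hz
      have hzy' := hzy.trans_lt hyy'
      exact ⟨z, hxz, hzy', le_antisymm ((hPl x z hz).trans hlc.le)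
        (minLevel_le_of_mem (mem_uIcc_of_le' hxz.le hzy'.le))⟩
    rcases hc.2.eq_or_lt with rfl | hcy
    · obtain ⟨z, hz, hzy⟩ := hQ (Iio c) y' hyy'
      have hxz : z < c := hQs (Iio c) hz
      have hzy' := hxy'.trans_le hzy
      exact ⟨z, hzy', hxz, le_antisymm ((hQl c z hz).trans hlc.le)
        (minLevel_le_of_mem (mem_uIcc_of_le' hzy'.le hxz.le))⟩
    exact ⟨c, hxc, hcy, hlc⟩
  · obtain ⟨a, hxa, hay, ha⟩ := hdense.exists_between_notMem hxy (hXc ξ)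
    obtain ⟨c, hac, hlc, hm⟩ := hgt a ξ hξ (not_lt.1 fun h => ha ((hXl ξ hξ a).2 h))
    refine ⟨c, hxa.trans hac, ?_, hlc⟩
    by_contra! hyc
    have := minLevel_le_of_mem (l := l) (mem_uIcc_of_le' hay.le hyc)
    exact absurd (hm ▸ this) (not_le.2 hy)
  · have haX := hnotMem ξ hξ a ha
    obtain ⟨y, hy, hay⟩ : ∃ y ∈ gapClass (X ξ) a, y < a := by
      by_cases h : ξ = ⊥
      · subst h
        obtain ⟨y, hy⟩ := hnomin.exists_lt a
        exact ⟨y, huniv a ▸ Set.mem_univ y, hy⟩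
      by_contra! h1
      refine hL ⟨?_, h⟩
      rw [← hleft]
      exact ⟨_, hX1 ξ h ▸ isComplementaryInterval_gapClass haX, a, mem_gapClass_self haX, h1⟩
    obtain ⟨c, hc, hyc⟩ := hP _ y hy
    have hlc := hcl ξ hξ a ha c (Or.inr hc)
    refine ⟨c, hyc.trans_lt hay, hlc, le_antisymm ((minLevel_le_left l c a).trans hlc.le) ?_⟩
    rw [minLevel_comm]
    exact (hgap ξ hξ a c).1 (hPs _ hc)
  · have haX := hnotMem ξ hξ a ha
    have hξ0 : ξ ≠ ⊥ := hL.2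
    have hL' : ξ ∈ leftHatSet D := hhat ▸ hL.1
    obtain ⟨m, hm, hmin⟩ := hL' (gapClass (X ξ) a) (hX1 ξ hξ0 ▸ isComplementaryInterval_gapClass haX)
    obtain ⟨c, hc, hcm⟩ := hP _ m hm
    obtain rfl : c = m := le_antisymm hcm (hmin (hPs _ hc))
    have hlc := hcl ξ hξ a ha c (Or.inr hc)
    refine ⟨c, hmin (mem_gapClass_self haX), hlc, le_antisymm ((minLevel_le_left l c a).trans hlc.le)
      ?_, fun x hx => ?_⟩
    · rw [minLevel_comm]
      exact (hgap ξ hξ a c).1 hm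
    · by_contra! h
      rw [hlc, minLevel_comm, ← hgap ξ hξ] at h
      exact absurd (hmin (mem_gapClass_trans hm h)) (not_le.2 hx)
  · obtain ⟨a, ha⟩ : ∃ a, a ∉ X ξ := by
      by_contra! h
      exact Set.not_countable_univ (α := A) ((hXc ξ).mono fun y _ => h y)
    obtain ⟨c, -, hc, -⟩ := hgt a ξ hξ (not_lt.1 fun h => ha ((hXl ξ hξ a).2 h))
    exact ⟨c, hc⟩

/-- For a point `c` of least level between the second coordinates, take a countable cofinal subset
of the first coordinates of those pairs of `K n` whose second coordinate is at most `c`. Its members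
have level at most that of `c`, and one of them is on or above `q.1`. Exchanging the two lines gives
the reverse inequality. -/
theorem exists_minLevel_le {A B : Type u} [LinearOrder A] [LinearOrder B] {F : OmegaOne → Set B}
    {σ : A → OmegaOne} {τ : B → OmegaOne} {K : ℕ → Set (A × B)} (hC : IsCountryman A)
    (hF : IsDecomposition F) (hτ : ∀ b ξ, b ∈ F ξ ↔ τ b ≤ ξ) (hK : IsChainCover K) :
    ∃ N : OmegaOne → Set A, (∀ η, (N η).Countable) ∧ ∀ Φ : OmegaOne → OmegaOne,
      (∀ η, ∀ y ∈ N η, σ y ≤ Φ η) → ∀ n, ∀ q ∈ K n, ∀ r ∈ K n,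
      OmegaOne.floor Φ (σ q.1) = OmegaOne.floor Φ (τ q.2) →
      OmegaOne.floor Φ (σ r.1) = OmegaOne.floor Φ (τ r.2) →
      minLevel (fun a => OmegaOne.floor Φ (σ a)) q.1 r.1 ≤
        minLevel (fun b => OmegaOne.floor Φ (τ b)) q.2 r.2 := by
  obtain ⟨K', hK'⟩ := hC.exists_isChainCover
  choose Q hQs hQc hQ using fun Y : Set A => hK'.exists_countable_cofinal Y
  refine ⟨fun η => ⋃ n, ⋃ b ∈ F η, Q {x | ∃ y ≤ b, (x, y) ∈ K n},
    fun η => countable_iUnion fun n => (hF.countable η).biUnion fun b _ => hQc _, ?_⟩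
  intro Φ hN n q hq r hr h1 h2
  wlog hqr : q ≤ r generalizing q r
  · rw [minLevel_comm, minLevel_comm (fun b => OmegaOne.floor Φ (τ b))]
    exact this r hr q hq h2 h1 (((hK.1 n).total hq hr).resolve_left hqr)
  obtain ⟨c, hc, hlc⟩ := exists_level_eq_minLevel (fun b => OmegaOne.floor Φ (τ b)) q.2 r.2
  rw [uIcc_of_le hqr.2] at hc
  rw [← hlc]
  obtain ⟨e, he, hqe⟩ := hQ {x | ∃ y ≤ c, (x, y) ∈ K n} q.1 ⟨q.2, hc.1, hq⟩
  have hle : OmegaOne.floor Φ (σ e) ≤ OmegaOne.floor Φ (τ c) := OmegaOne.floor_le_floor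
    (hN (τ c) e (mem_iUnion.2 ⟨n, mem_biUnion ((hτ c _).2 le_rfl) he⟩))
  obtain ⟨y, hyc, hey⟩ := hQs _ he
  by_cases her : e ≤ r.1
  · exact (minLevel_le_of_mem (l := fun a => OmegaOne.floor Φ (σ a))
      (mem_uIcc_of_le' hqe her)).trans hle
  -- When the witness passes `r.1`, the chain forces `c = r.2`, and the equality of the levels of
  -- `r` finishes.
  · have h3 : r.2 ≤ y := by
      by_contra! h
      exact hK.not_lt_and_gt hr hey ⟨not_le.1 her, h⟩
    have h4 : c = r.2 := le_antisymm hc.2 (h3.trans hyc)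
    rw [h4]
    exact (minLevel_le_right (fun a => OmegaOne.floor Φ (σ a)) q.1 r.1).trans h2.le

theorem IsDecomposition.mk_le {A : Type u} [LinearOrder A] {D : OmegaOne → Set A}
    (hD : IsDecomposition D) : #A ≤ ℵ₁ := by
  obtain ⟨σ, hσ, -⟩ := hD.exists_rank
  choose f hf using fun ξ => (countable_iff_exists_injOn (s := D ξ)).1 (hD.countable ξ)
  have hinj : Function.Injective fun a => (σ a, f (σ a) a) := by
    intro a b hab
    obtain ⟨h1, h2⟩ := Prod.mk.inj hab
    rw [← h1] at h2
    exact hf (σ a) ((hσ a _).2 le_rfl) ((hσ b _).2 h1.ge) h2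
  have h1 := Cardinal.lift_mk_le_lift_mk_of_injective hinj
  have h2 : #(OmegaOne × ℕ) = ℵ₁ := by
    rw [Cardinal.mk_prod, Cardinal.mk_Iio_ordinal]
    simp [Cardinal.aleph0_le_aleph]
  rw [h2] at h1
  simpa using h1

/-- Decompositions with the same kind of complementary intervals give epimorphisms. -/
theorem exists_epimorphism_of_isDecomposition (hMA : MartinAxiomAlephOne.{u}) {A B : Type u}
    [LinearOrder A] [LinearOrder B] {D : OmegaOne → Set A} {F : OmegaOne → Set B}
    {Λ Λ' : Set OmegaOne} {K : ℕ → Set (A × B)} (hK : IsChainCover K) (hA : IsCountryman A)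
    (hB : IsCountryman B) (hdA : IsAlephOneDense A) (hdB : IsAlephOneDense B)
    (hD : IsDecomposition D) (hF : IsDecomposition F)
    (hleft : leftSet D = Λ) (hhat : leftHatSet D = Λ) (hright : rightSet D = ∅)
    (hleft' : leftSet F = Λ') (hhat' : leftHatSet F = Λ') (hright' : rightSet F = ∅)
    (hΛ : Λ ⊆ Λ') : ∃ f : A → B, Monotone f ∧ Function.Surjective f := by
  obtain ⟨σ, hσ, hσl⟩ := hD.exists_rank
  obtain ⟨τ, hτ, hτl⟩ := hF.exists_rank
  obtain ⟨N₁, hc₁, h₁⟩ := exists_isLevelled hA hdA hD hσ hσl hleft hhat hright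
  obtain ⟨N₂, hc₂, h₂⟩ := exists_isLevelled hB hdB hF hτ hτl hleft' hhat' hright'
  obtain ⟨N₃, hc₃, h₃⟩ := exists_minLevel_le (σ := σ) hA hF hτ hK
  obtain ⟨N₄, hc₄, h₄⟩ := exists_minLevel_le (σ := τ) hB hD hσ hK.swap
  obtain ⟨Φ₁, hΦ₁⟩ := exists_bounding_function σ (fun η => N₁ η ∪ N₃ η)
    fun η => (hc₁ η).union (hc₃ η)
  obtain ⟨Φ₂, hΦ₂⟩ := exists_bounding_function τ (fun η => N₂ η ∪ N₄ η)
    fun η => (hc₂ η).union (hc₄ η)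
  choose s hs using fun ξ : OmegaOne => exists_gt ξ
  let Φ : OmegaOne → OmegaOne := fun η => max (max (Φ₁ η) (Φ₂ η)) (s η)
  have hle₁ : ∀ η, Φ₁ η ≤ Φ η := fun η => (le_max_left _ _).trans (le_max_left _ _)
  have hle₂ : ∀ η, Φ₂ η ≤ Φ η := fun η => (le_max_right _ _).trans (le_max_left _ _)
  have hΦ : ∀ η, η < Φ η := fun η => (hs η).trans_le (le_max_right _ _)
  refine exists_epimorphism_of_isLevelled hMA
    (h₁ Φ hΦ fun η y hy => (hΦ₁ η y (Or.inl hy)).trans (hle₁ η))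
    (h₂ Φ hΦ fun η y hy => (hΦ₂ η y (Or.inl hy)).trans (hle₂ η))
    (sdiff_subset_sdiff_left hΛ) hK ?_ hD.mk_le hF.mk_le
  intro n q hq r hr hlq hlr
  refine le_antisymm ?_ ?_
  · exact h₃ Φ (fun η y hy => (hΦ₁ η y (Or.inr hy)).trans (hle₁ η)) n q hq r hr hlq hlr
  · exact h₄ Φ (fun η y hy => (hΦ₂ η y (Or.inr hy)).trans (hle₂ η)) n q.swap hq r.swap hr
      hlq.symm hlr.symm

/-- The common ambient line `T` provides the chains covering `C α × C β`. The left sets increase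
with the index, which gives the epimorphism, and `S α` is a stationary part of their difference,
which excludes the reverse one. -/
theorem IsCountrymanFamily.epiLT (hMA : MartinAxiomAlephOne.{u}) {S : OmegaOne → Set OmegaOne}
    (hst : ∀ α, IsStationary (S α)) (hdisj : ∀ α β, α ≠ β → Disjoint (S α) (S β))
    {T : Type u} [LinearOrder T] {C : OmegaOne → Type u} [∀ α, LinearOrder (C α)]
    {D : ∀ α, OmegaOne → Set (C α)} (h : IsCountrymanFamily S T C D) {α β : OmegaOne}
    (hαβ : α < β) : EpiLT (C β) (C α) := by
  have hne : ∀ α, Nonempty (C α) := fun α => (h.dense α).1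
  obtain ⟨K, hK⟩ := h.countryman_ambient.exists_isChainCover
  obtain ⟨f, hf⟩ := h.embeds α
  obtain ⟨g, hg⟩ := h.embeds β
  refine ⟨Or.inr ?_, ?_⟩
  · refine exists_epimorphism_of_isDecomposition hMA (hK.comap hf hg) (h.countryman α)
      (h.countryman β) (h.dense α) (h.dense β) (h.decomposition α) (h.decomposition β)
      (h.left_eq α) (h.leftHat_eq α) (h.right_eq α) (h.left_eq β) (h.leftHat_eq β) (h.right_eq β) ?_
    exact iUnion_subset fun ξ => subset_iUnion_of_subset ⟨ξ.1, lt_trans ξ.2 hαβ⟩ subset_rfl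
  · rintro (hemp | hex)
    · exact not_isEmpty_of_nonempty _ hemp
    refine not_exists_epimorphism (h.countryman β) (h.countryman α) (h.decomposition β)
      (h.decomposition α) ((hst α).mono fun ξ hξ => ⟨?_, fun hξ' => ?_⟩) hex
    · rw [h.leftHat_eq β]
      exact mem_iUnion.2 ⟨⟨α, hαβ⟩, hξ⟩
    · rw [h.left_eq α] at hξ'
      obtain ⟨⟨γ, hγ⟩, h1⟩ := mem_iUnion.1 hξ'
      exact Set.disjoint_left.1 (hdisj α γ (ne_of_gt hγ)) hξ h1

/-! ### Coherent sequences -/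

section Coherent

variable {ι : Type*} [LinearOrder ι]

/-- A coherent sequence of finite-to-one functions on the initial segments of `ι`. -/
structure IsCoherentSeq (e : ι → ι → ℕ) : Prop where
  finite_le : ∀ i n, {j | j < i ∧ e i j ≤ n}.Finite
  finite_ne : ∀ i i', i ≤ i' → {j | j < i ∧ e i j ≠ e i' j}.Finite

/-- Let `s` enumerate the predecessors of `i`. On coordinates first covered at stage `m`, the new
function copies `e (s m)` but is raised to at least `m`. The raising makes it finite-to-one; below
`i' = s k` only stages up to `k` occur, and each contributes finitely many changes. -/
theorem exists_isCoherentSeq [WellFoundedLT ι] (hι : ∀ i : ι, (Iio i).Countable) :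
    ∃ e : ι → ι → ℕ, IsCoherentSeq e := by
  classical
  let Good : ∀ i : ι, (∀ j < i, ι → ℕ) → (ι → ℕ) → Prop := fun i f g =>
    (∀ n, {j | j < i ∧ g j ≤ n}.Finite) ∧ ∀ i' (h : i' < i), {j | j < i' ∧ f i' h j ≠ g j}.Finite
  -- The value `0` is a mere default of the recursion; `hgood` shows that a good function always
  -- exists.
  let step : ∀ i : ι, (∀ j < i, ι → ℕ) → ι → ℕ := fun i f =>
    if h : ∃ g, Good i f g then h.choose else 0
  let e : ι → ι → ℕ := wellFounded_lt.fix step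
  have he : ∀ i, e i = step i fun j _ => e j := fun i => wellFounded_lt.fix_eq step i
  have hgood : ∀ i, Good i (fun j _ => e j) (e i) := by
    intro i
    induction i using WellFoundedLT.induction with
    | _ i ih =>
    suffices h : ∃ g, Good i (fun j _ => e j) g by
      have h1 : e i = h.choose := by rw [he i]; exact dif_pos h
      rw [h1]
      exact h.choose_spec
    rcases (Iio i).eq_empty_or_nonempty with hemp | hne
    · have hno : ∀ j, ¬ j < i := fun j hj => by
        have : j ∈ Iio i := hj
        rwa [hemp] at this
      refine ⟨0, fun n => ?_, fun i' h => absurd h (hno i')⟩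
      simp [hno]
    obtain ⟨s, hs⟩ := (hι i).exists_eq_range hne
    have hsi : ∀ n, s n < i := fun n => by
      have : s n ∈ Iio i := hs ▸ mem_range_self n
      exact this
    have hfin : ∀ j, j < i → ∃ n, j ≤ s n := by
      intro j hj
      obtain ⟨n, hn⟩ : j ∈ range s := hs ▸ hj
      exact ⟨n, hn.ge⟩
    have hagree : ∀ i' < i, ∀ m, {j | j < i' ∧ j ≤ s m ∧ e i' j ≠ e (s m) j}.Finite := by
      intro i' hi' m
      rcases lt_trichotomy i' (s m) with h | h | h
      · exact ((ih _ (hsi m)).2 i' h).subset fun j hj => ⟨hj.1, hj.2.2⟩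
      · rw [h]
        simp
      · refine (((ih _ hi').2 (s m) h).union (Set.finite_singleton (s m))).subset fun j hj => ?_
        rcases hj.2.1.eq_or_lt with h1 | h1
        · exact Or.inr h1
        · exact Or.inl ⟨h1, hj.2.2.symm⟩
    let N : ι → ℕ := fun j => if h : ∃ n, j ≤ s n then Nat.find h else 0
    have hN : ∀ j < i, j ≤ s (N j) := by
      intro j hj
      simp only [N, dif_pos (hfin j hj)]
      exact Nat.find_spec (hfin j hj)
    have hNle : ∀ j n, j ≤ s n → N j ≤ n := by
      intro j n h
      have h' : ∃ n, j ≤ s n := ⟨n, h⟩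
      simp only [N, dif_pos h']
      exact Nat.find_min' h' h
    refine ⟨fun j => max (e (s (N j)) j) (N j), fun n => ?_, fun i' hi' => ?_⟩
    · refine ((Set.finite_Iic n).biUnion fun m _ => ((ih _ (hsi m)).1 n).union
        (Set.finite_singleton (s m))).subset fun j hj => ?_
      obtain ⟨hj1, hj2⟩ := hj
      refine mem_biUnion (x := N j) ((le_max_right _ _).trans hj2) ?_
      rcases (hN j hj1).eq_or_lt with h1 | h1
      · exact Or.inr h1
      · exact Or.inl ⟨h1, (le_max_left _ _).trans hj2⟩
    · obtain ⟨k, hk⟩ : i' ∈ range s := hs ▸ hi'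
      refine ((Set.finite_Iic k).biUnion fun m _ => (hagree i' hi' m).union
        ((ih i' hi').1 m)).subset fun j hj => ?_
      obtain ⟨hj1, hj2⟩ := hj
      refine mem_biUnion (x := N j) (hNle j k (hk ▸ hj1.le)) ?_
      by_cases h1 : e i' j = e (s (N j)) j
      · refine Or.inr ⟨hj1, ?_⟩
        by_contra! h2
        refine hj2 ?_
        change e i' j = max (e (s (N j)) j) (N j)
        rw [← h1, max_eq_left h2.le]
      · exact Or.inl ⟨hj1, hN j (hj1.trans hi'), h1⟩
  refine ⟨e, fun i n => (hgood i).1 n, fun i i' h => ?_⟩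
  rcases h.eq_or_lt with rfl | h
  · simp
  · exact (hgood i').2 i h

end Coherent

/-! ### Lexicographically ordered trees -/

/-- The values of the sequences used below; `⊤` marks the coordinates after the end. -/
abbrev Val : Type := WithTop ℚ≥0

namespace Val

/-- The integral part of a value. -/
noncomputable def height (p : Val) : ℕ := ⌊p.untopD 0⌋₊

/-- The shift by one keeps these values above `⊥`, which is reserved for last values, and makes the
height exceed `n`. -/
def ofNat (n : ℕ) : Val := ((n + 1 : ℚ≥0) : Val)

theorem height_mono {p q : Val} (h : p ≤ q) (hq : q < ⊤) : height p ≤ height q := by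
  lift q to ℚ≥0 using hq.ne
  lift p to ℚ≥0 using (h.trans_lt (WithTop.coe_lt_top q)).ne
  simpa [height] using Nat.floor_mono (WithTop.coe_le_coe.1 h)

theorem lt_height_ofNat (n : ℕ) : n < height (ofNat n) := by
  have : ⌊(n + 1 : ℚ≥0)⌋₊ = n + 1 := by exact_mod_cast Nat.floor_natCast (R := ℚ≥0) (n + 1)
  have h1 : height (ofNat n) = ⌊(n + 1 : ℚ≥0)⌋₊ := rfl
  rw [h1, this]
  exact n.lt_succ_self

theorem bot_lt_ofNat (n : ℕ) : ⊥ < ofNat n := by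
  rw [bot_lt_iff_ne_bot]
  intro h
  have h1 := lt_height_ofNat n
  rw [h] at h1
  have h2 : height ⊥ = 0 := by
    have : (⊥ : Val) = ((0 : ℚ≥0) : Val) := rfl
    rw [this]
    simp [height]
  omega

theorem ofNat_lt_top (n : ℕ) : ofNat n < ⊤ := WithTop.coe_lt_top _

end Val

section Points

variable {ι : Type*} [LinearOrder ι]

/-- `x` is a sequence with last coordinate `i`, whose restriction below `i` is a finite modification
of the member `e i` of the coherent sequence. -/
structure IsPoint (e : ι → ι → ℕ) (i : ι) (x : ι → Val) : Prop where
  bot_lt : ∀ j < i, ⊥ < x j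
  lt_top : ∀ j ≤ i, x j < ⊤
  eq_top : ∀ j, i < j → x j = ⊤
  finite_ne : {j | j < i ∧ x j ≠ Val.ofNat (e i j)}.Finite

namespace IsPoint

variable {e : ι → ι → ℕ} {i i' : ι} {x y : ι → Val}

theorem lt_top_iff (h : IsPoint e i x) {j : ι} : x j < ⊤ ↔ j ≤ i := by
  refine ⟨fun h1 => ?_, h.lt_top j⟩
  by_contra! h2
  exact absurd (h.eq_top j h2) h1.ne

theorem unique (h : IsPoint e i x) (h' : IsPoint e i' x) : i = i' :=
  le_antisymm (h'.lt_top_iff.1 (h.lt_top i le_rfl)) (h.lt_top_iff.1 (h'.lt_top i' le_rfl))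

theorem finite_height (he : IsCoherentSeq e) (h : IsPoint e i x) (n : ℕ) :
    {j | j ≤ i ∧ Val.height (x j) ≤ n}.Finite := by
  refine ((h.finite_ne.union (he.finite_le i n)).union (Set.finite_singleton i)).subset ?_
  rintro j ⟨hj, hn⟩
  rcases hj.eq_or_lt with rfl | hj
  · exact Or.inr rfl
  refine Or.inl ?_
  by_cases hx : x j = Val.ofNat (e i j)
  · refine Or.inr ⟨hj, ?_⟩
    rw [hx] at hn
    exact (Val.lt_height_ofNat _).le.trans hn
  · exact Or.inl ⟨hj, hx⟩

theorem finite_ne_of_le (he : IsCoherentSeq e) (h : IsPoint e i x) {k : ι} (hk : k ≤ i) :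
    {j | j < k ∧ x j ≠ Val.ofNat (e k j)}.Finite := by
  refine (h.finite_ne.union (he.finite_ne k i hk)).subset ?_
  rintro j ⟨hj, hx⟩
  by_cases h1 : e k j = e i j
  · rw [h1] at hx
    exact Or.inl ⟨hj.trans_le hk, hx⟩
  · exact Or.inr ⟨hj, h1⟩

theorem finite_ne_points (he : IsCoherentSeq e) (h : IsPoint e i x) (h' : IsPoint e i' y)
    (hi : i ≤ i') : {j | j ≤ i ∧ x j ≠ y j}.Finite := by
  refine ((h.finite_ne.union (h'.finite_ne_of_le he hi)).union (Set.finite_singleton i)).subset ?_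
  rintro j ⟨hj, hx⟩
  rcases hj.eq_or_lt with rfl | hj
  · exact Or.inr rfl
  refine Or.inl ?_
  by_cases h1 : x j = Val.ofNat (e i j)
  · exact Or.inr ⟨hj, fun h2 => hx (h1.trans h2.symm)⟩
  · exact Or.inl ⟨hj, h1⟩

end IsPoint

/-- The finite set of coordinates at which two sequences may differ or are small. -/
structure IsTrace (i : ι) (x y : ι → Val) (n : ℕ) (F : Finset ι) : Prop where
  le : ∀ j ∈ F, j ≤ i
  last : i ∈ F
  left_le : ∀ j ∈ F, Val.height (x j) ≤ n
  right_le : ∀ j ∈ F, Val.height (y j) ≤ n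
  eq : ∀ j ≤ i, j ∉ F → x j = y j
  lt : ∀ j ≤ i, j ∉ F → n < Val.height (x j)

/-- Points differ at finitely many coordinates. With `n` bounding the heights there and at `i`, the
coordinates of height at most `n` form a finite set outside of which the two points agree. -/
theorem IsPoint.exists_isTrace {e : ι → ι → ℕ} {i i' : ι} {x y : ι → Val} (he : IsCoherentSeq e)
    (h : IsPoint e i x) (h' : IsPoint e i' y) (hi : i ≤ i') : ∃ n F, IsTrace i x y n F := by
  classical
  let B := insert i (h.finite_ne_points he h' hi).toFinset
  let n := B.sup fun j => max (Val.height (x j)) (Val.height (y j))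
  have hB : ∀ j ∈ B, Val.height (x j) ≤ n ∧ Val.height (y j) ≤ n := fun j hj =>
    max_le_iff.1 (Finset.le_sup (f := fun j => max (Val.height (x j)) (Val.height (y j))) hj)
  have hBne : ∀ j ≤ i, j ∉ B → x j = y j := by
    intro j hj hjB
    by_contra hne
    exact hjB (Finset.mem_insert_of_mem ((Set.Finite.mem_toFinset _).2 ⟨hj, hne⟩))
  refine ⟨n, (h.finite_height he n).toFinset, ?_, ?_, ?_, ?_, ?_, ?_⟩
  · intro j hj
    exact ((Set.Finite.mem_toFinset _).1 hj).1
  · exact (Set.Finite.mem_toFinset _).2 ⟨le_rfl, (hB i (Finset.mem_insert_self _ _)).1⟩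
  · intro j hj
    exact ((Set.Finite.mem_toFinset _).1 hj).2
  · intro j hj
    obtain ⟨h1, h2⟩ := (Set.Finite.mem_toFinset _).1 hj
    by_cases hjB : j ∈ B
    · exact (hB j hjB).2
    · rwa [← hBne j h1 hjB]
  · intro j hj hjF
    by_contra hne
    have hjB : j ∈ B := by
      by_contra hjB
      exact hne (hBne j hj hjB)
    exact hjF ((Set.Finite.mem_toFinset _).2 ⟨hj, (hB j hjB).1⟩)
  · intro j hj hjF
    by_contra! hle
    exact hjF ((Set.Finite.mem_toFinset _).2 ⟨hj, hle⟩)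

open Classical in
/-- The values along a trace, together with the positions at which they are attained. -/
noncomputable def traceType (x y : ι → Val) (F : Finset ι) : Finset (ℕ × Val × Val) :=
  F.image fun j => ((F.filter (· < j)).card, x j, y j)

theorem card_filter_lt_inj {F : Finset ι} {j k : ι} (hj : j ∈ F) (hk : k ∈ F)
    (h : (F.filter (· < j)).card = (F.filter (· < k)).card) : j = k := by
  wlog hlt : j ≤ k generalizing j k
  · exact (this hk hj h.symm (not_le.1 hlt).le).symm
  by_contra hne
  have hjk := lt_of_le_of_ne hlt hne
  have : (F.filter (· < j)) ⊂ (F.filter (· < k)) := by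
    rw [Finset.ssubset_iff_of_subset]
    · exact ⟨j, by simp [hj, hjk], by simp⟩
    · intro a ha
      rw [Finset.mem_filter] at ha ⊢
      exact ⟨ha.1, ha.2.trans hjk⟩
  exact absurd h (Finset.card_lt_card this).ne

/-- When the traces agree below `j`, the coordinate `j` has the same position in both, and the type
records the values at that position. -/
theorem eq_of_traceType_eq {x y x' y' : ι → Val} {F F' : Finset ι}
    (ht : traceType x y F = traceType x' y' F') {j : ι} (hj : j ∈ F) (hj' : j ∈ F')
    (hlow : ∀ k < j, k ∈ F ↔ k ∈ F') : x j = x' j ∧ y j = y' j := by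
  classical
  have h1 : ((F.filter (· < j)).card, x j, y j) ∈ traceType x' y' F' := by
    rw [← ht]
    exact Finset.mem_image_of_mem _ hj
  obtain ⟨k, hk, h2⟩ := Finset.mem_image.1 h1
  obtain ⟨h3, h4⟩ := Prod.mk.inj h2
  obtain ⟨h4, h5⟩ := Prod.mk.inj h4
  have h6 : F.filter (· < j) = F'.filter (· < j) := by
    ext a
    simp only [Finset.mem_filter]
    exact ⟨fun h => ⟨(hlow a h.2).1 h.1, h.2⟩, fun h => ⟨(hlow a h.2).2 h.1, h.2⟩⟩
  rw [h6] at h3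
  obtain rfl := card_filter_lt_inj hk hj' h3
  exact ⟨h4.symm, h5.symm⟩

/-- The last coordinate of a trace is determined by the trace type. -/
theorem not_subset_of_traceType_eq {x y x' y' : ι → Val} {F F' : Finset ι}
    (ht : traceType x y F = traceType x' y' F') {j : ι} (hj : j ∈ F) :
    ¬ F' ⊆ F.filter (· < j) := by
  classical
  intro hsub
  have h1 : ((F.filter (· < j)).card, x j, y j) ∈ traceType x' y' F' := by
    rw [← ht]
    exact Finset.mem_image_of_mem _ hj
  obtain ⟨k, hk, h2⟩ := Finset.mem_image.1 h1
  have h3 := (Prod.mk.inj h2).1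
  have h4 : F'.filter (· < k) ⊂ F' := by
    rw [Finset.ssubset_iff_of_subset (Finset.filter_subset _ _)]
    exact ⟨k, hk, by simp⟩
  have h5 := Finset.card_lt_card h4
  have h6 := Finset.card_le_card hsub
  omega

/-- Compare the first differences `ζ` of `x, x'` and `η` of `y, y'`. Below the smaller one the
traces agree, since membership is read off from the heights. At the smaller one, coordinates in both
traces are fixed by the type, while outside both traces `x` agrees with `y` and `x'` with `y'`.
Mixed membership is possible only if `ζ = η`, and then the smaller value would have the larger
height. -/
theorem not_lt_and_gt_of_traceType_eq {e : ι → ι → ℕ} {i i₁ i' : ι} {x y x' y' : ι → Val} {n : ℕ}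
    {F F' : Finset ι} (hx : IsPoint e i x) (hy : IsPoint e i₁ y) (hi : i ≤ i₁)
    (hx' : IsPoint e i' x') (hF : IsTrace i x y n F)
    (hF' : IsTrace i' x' y' n F') (ht : traceType x y F = traceType x' y' F') :
    ¬ (toLex x < toLex x' ∧ toLex y' < toLex y) := by
  classical
  rintro ⟨⟨ζ, hζ, hζ'⟩, ⟨η, hη, hη'⟩⟩
  change ∀ j, j < ζ → x j = x' j at hζ
  change x ζ < x' ζ at hζ'
  change ∀ j, j < η → y' j = y j at hη
  change y' η < y η at hη'
  have hζi : ζ ≤ i := hx.lt_top_iff.1 (hζ'.trans_le le_top)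
  have hmemx : ∀ j < ζ, j ≤ i' → (j ∈ F ↔ j ∈ F') := by
    intro j hj hj'
    constructor <;> intro h <;> by_contra h1
    · exact absurd (hF.left_le j h) (not_le.2 (hζ j hj ▸ hF'.lt j hj' h1))
    · exact absurd (hF'.left_le j h) (not_le.2 (hζ j hj ▸ hF.lt j (hj.le.trans hζi) h1))
  -- Otherwise the whole of `F'` would lie in `F` strictly below its last element `i`, which the
  -- common type forbids.
  have hζi' : ζ ≤ i' := by
    by_contra! h
    refine not_subset_of_traceType_eq ht hF.last fun j hj => ?_
    have h1 := (hF'.le j hj).trans_lt h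
    exact Finset.mem_filter.2 ⟨(hmemx j h1 (hF'.le j hj)).2 hj, h1.trans_le hζi⟩
  replace hmemx : ∀ j < ζ, (j ∈ F ↔ j ∈ F') := fun j hj => hmemx j hj (hj.le.trans hζi')
  have hmemy : ∀ j < η, j ≤ ζ → (j ∈ F ↔ j ∈ F') := by
    intro j hj hj'
    constructor <;> intro h <;> by_contra h1
    · refine absurd (hF.right_le j h) (not_le.2 ?_)
      rw [← hη j hj, ← hF'.eq j (hj'.trans hζi') h1]
      exact hF'.lt j (hj'.trans hζi') h1
    · refine absurd (hF'.right_le j h) (not_le.2 ?_)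
      rw [hη j hj, ← hF.eq j (hj'.trans hζi) h1]
      exact hF.lt j (hj'.trans hζi) h1
  rcases lt_trichotomy η ζ with hlt | heq | hgt
  · by_cases hηF : η ∈ F
    · have := eq_of_traceType_eq ht hηF ((hmemx η hlt).1 hηF) fun k hk => hmemx k (hk.trans hlt)
      exact absurd this.2 hη'.ne'
    · have h1 := hF.eq η (hlt.le.trans hζi) hηF
      have h2 := hF'.eq η (hlt.le.trans hζi') fun h => hηF ((hmemx η hlt).2 h)
      exact absurd (h1.symm.trans ((hζ η hlt).trans h2)) hη'.ne'
  · subst heq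
    by_cases h1 : η ∈ F <;> by_cases h2 : η ∈ F'
    · exact absurd (eq_of_traceType_eq ht h1 h2 hmemx).1 hζ'.ne
    · have h3 := Val.height_mono hη'.le (hy.lt_top η (hζi.trans hi))
      rw [← hF'.eq η hζi' h2] at h3
      exact absurd ((hF'.lt η hζi' h2).trans_le (h3.trans (hF.right_le η h1))) (lt_irrefl _)
    · have h3 := Val.height_mono hζ'.le (hx'.lt_top η hζi')
      exact absurd ((hF.lt η hζi h1).trans_le (h3.trans (hF'.left_le η h2))) (lt_irrefl _)
    · rw [hF.eq η hζi h1, hF'.eq η hζi' h2] at hζ'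
      exact absurd hζ' hη'.not_gt
  · by_cases hζF : ζ ∈ F
    · have := eq_of_traceType_eq ht hζF ((hmemy ζ hgt le_rfl).1 hζF)
        fun k hk => hmemy k (hk.trans hgt) hk.le
      exact absurd this.1 hζ'.ne
    · have h1 := hF.eq ζ hζi hζF
      have h2 := hF'.eq ζ hζi' fun h => hζF ((hmemy ζ hgt le_rfl).2 h)
      exact absurd (h1.trans ((hη ζ hgt).symm.trans h2.symm)) hζ'.ne

end Points

section TreeLine

variable {ι : Type u} [LinearOrder ι]

/-- The points of the tree of finite modifications of `e`, where the value `⊥` may occur as a last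
value only on the levels in `Λ`. -/
def TreeLine (e : ι → ι → ℕ) (Λ : Set ι) : Type u :=
  {x : Lex (ι → Val) // ∃ i, IsPoint e i (ofLex x) ∧ (ofLex x i = ⊥ → i ∈ Λ)}

namespace TreeLine

variable {e : ι → ι → ℕ} {Λ : Set ι}

noncomputable instance [WellFoundedLT ι] : LinearOrder (TreeLine e Λ) :=
  inferInstanceAs (LinearOrder {x : Lex (ι → Val) //
    ∃ i, IsPoint e i (ofLex x) ∧ (ofLex x i = ⊥ → i ∈ Λ)})

/-- The coordinates of a point. -/
def coord (x : TreeLine e Λ) : ι → Val := ofLex x.1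

noncomputable def level (x : TreeLine e Λ) : ι := x.2.choose

theorem isPoint (x : TreeLine e Λ) : IsPoint e x.level x.coord := x.2.choose_spec.1

theorem level_mem (x : TreeLine e Λ) : x.coord x.level = ⊥ → x.level ∈ Λ := x.2.choose_spec.2

theorem level_eq {x : TreeLine e Λ} {i : ι} (h : IsPoint e i x.coord) : x.level = i :=
  x.isPoint.unique h

def mk {i : ι} {x : ι → Val} (h : IsPoint e i x) (h' : x i = ⊥ → i ∈ Λ) : TreeLine e Λ :=
  ⟨toLex x, i, h, h'⟩

theorem coord_mk {i : ι} {x : ι → Val} (h : IsPoint e i x) (h' : x i = ⊥ → i ∈ Λ) :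
    (mk (Λ := Λ) h h').coord = x := rfl

theorem level_mk {i : ι} {x : ι → Val} (h : IsPoint e i x) (h' : x i = ⊥ → i ∈ Λ) :
    (mk (Λ := Λ) h h').level = i := level_eq h

theorem ext {x y : TreeLine e Λ} (h : x.coord = y.coord) : x = y := Subtype.ext h

theorem lt_top_iff {x : TreeLine e Λ} {j : ι} : x.coord j < ⊤ ↔ j ≤ x.level := x.isPoint.lt_top_iff

theorem bot_lt {x : TreeLine e Λ} {j : ι} (hj : j ≤ x.level) (hΛ : j ∉ Λ) : ⊥ < x.coord j := by
  rcases hj.eq_or_lt with rfl | hj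
  · exact bot_lt_iff_ne_bot.2 fun h => hΛ (x.level_mem h)
  · exact x.isPoint.bot_lt j hj

section Constructions

/-- The restriction of `x` below `j`, followed by the last value `p`. -/
noncomputable def cutFun (x : ι → Val) (j : ι) (p : Val) : ι → Val := fun k =>
  if k < j then x k else if k = j then p else ⊤

theorem isPoint_cutFun (he : IsCoherentSeq e) {i : ι} {x : ι → Val} (h : IsPoint e i x) {j : ι}
    (hj : j ≤ i) {p : Val} (hp : p < ⊤) : IsPoint e j (cutFun x j p) := by
  refine ⟨fun k hk => ?_, fun k hk => ?_, fun k hk => ?_, ?_⟩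
  · simp only [cutFun, if_pos hk]
    exact h.bot_lt k (hk.trans_le hj)
  · rcases hk.eq_or_lt with rfl | hk
    · simpa [cutFun] using hp
    · simp only [cutFun, if_pos hk]
      exact h.lt_top k (hk.le.trans hj)
  · simp [cutFun, hk.not_gt, hk.ne']
  · refine (h.finite_ne_of_le he hj).subset ?_
    rintro k ⟨hk, hne⟩
    refine ⟨hk, ?_⟩
    simpa only [cutFun, if_pos hk] using hne

/-- The restriction of `x` below `j`, followed by the value `p` and by a point of level `k`. -/
noncomputable def extendFun (e : ι → ι → ℕ) (x : ι → Val) (j : ι) (p : Val) (k : ι) : ι → Val :=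
  fun m => if m < j then x m else if m = j then p else if m ≤ k then Val.ofNat (e k m) else ⊤

theorem isPoint_extendFun (he : IsCoherentSeq e) {i : ι} {x : ι → Val} (h : IsPoint e i x) {j k : ι}
    (hj : j ≤ i) (hjk : j < k) {p : Val} (hp : p < ⊤) (hp' : ⊥ < p) :
    IsPoint e k (extendFun e x j p k) := by
  have hval : ∀ m, ⊥ < p → m ≤ k → ⊥ < extendFun e x j p k m ∧ extendFun e x j p k m < ⊤ := by
    intro m _ hmk
    unfold extendFun
    split_ifs with h1 h2
    · exact ⟨h.bot_lt m (h1.trans_le hj), h.lt_top m (h1.le.trans hj)⟩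
    · exact ⟨hp', hp⟩
    · exact ⟨Val.bot_lt_ofNat _, Val.ofNat_lt_top _⟩
  refine ⟨fun m hm => (hval m hp' hm.le).1, fun m hm => (hval m hp' hm).2, fun m hm => ?_, ?_⟩
  · simp [extendFun, (hjk.trans hm).not_gt, (hjk.trans hm).ne', hm.not_ge]
  · refine (((h.finite_ne_of_le he hj).union (he.finite_ne j k hjk.le)).union
      (Set.finite_singleton j)).subset ?_
    rintro m ⟨hm, hne⟩
    rcases lt_trichotomy m j with h1 | h1 | h1
    · refine Or.inl ?_
      simp only [extendFun, if_pos h1] at hne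
      by_cases h2 : e j m = e k m
      · exact Or.inl ⟨h1, h2 ▸ hne⟩
      · exact Or.inr ⟨h1, h2⟩
    · exact Or.inr h1
    · simp [extendFun, h1.not_gt, h1.ne', hm.le] at hne

theorem isPoint_base (i : ι) : IsPoint e i fun k => if k ≤ i then Val.ofNat (e i k) else ⊤ := by
  refine ⟨fun k hk => ?_, fun k hk => ?_, fun k hk => ?_, ?_⟩
  · simpa [hk.le] using Val.bot_lt_ofNat _
  · simpa [hk] using Val.ofNat_lt_top _
  · simp [hk.not_ge]
  · refine Set.finite_empty.subset ?_
    rintro k ⟨hk, hne⟩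
    simp [hk.le] at hne

noncomputable def base (e : ι → ι → ℕ) (Λ : Set ι) (i : ι) : TreeLine e Λ :=
  mk (isPoint_base i) fun h => by
    simp only [le_refl, if_true] at h
    exact absurd h (Val.bot_lt_ofNat _).ne'

theorem level_base (i : ι) : (base e Λ i).level = i := level_mk _ _

/-- The point with the coordinates of `x` below `j` and the last value `p` at `j`. -/
noncomputable def cut (he : IsCoherentSeq e) (x : TreeLine e Λ) {j : ι} (hj : j ≤ x.level) {p : Val}
    (hp : p < ⊤) (hΛ : p = ⊥ → j ∈ Λ) : TreeLine e Λ :=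
  mk (isPoint_cutFun he x.isPoint hj hp) fun h => hΛ (by simpa [cutFun] using h)

variable (he : IsCoherentSeq e) {x : TreeLine e Λ} {j : ι} (hj : j ≤ x.level) {p : Val}
    (hp : p < ⊤) (hΛ : p = ⊥ → j ∈ Λ)

theorem level_cut : (cut he x hj hp hΛ).level = j := level_mk _ _

theorem coord_cut_of_lt {k : ι} (hk : k < j) : (cut he x hj hp hΛ).coord k = x.coord k := by
  simp [cut, coord_mk, cutFun, hk]

theorem coord_cut_self : (cut he x hj hp hΛ).coord j = p := by
  simp [cut, coord_mk, cutFun]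

theorem coord_cut_of_gt {k : ι} (hk : j < k) : (cut he x hj hp hΛ).coord k = ⊤ := by
  simp [cut, coord_mk, cutFun, hk.not_gt, hk.ne']

end Constructions

variable [WellFoundedLT ι]

theorem lt_iff {x y : TreeLine e Λ} :
    x < y ↔ ∃ j, (∀ k < j, x.coord k = y.coord k) ∧ x.coord j < y.coord j := Iff.rfl

theorem strictMono_inclusion {Λ' : Set ι} (h : Λ ⊆ Λ') :
    StrictMono fun x : TreeLine e Λ => (mk x.isPoint fun hx => h (x.level_mem hx) : TreeLine e Λ') :=
  fun _ _ hxy => hxy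

theorem exists_first_difference {x y : TreeLine e Λ} (h : ∃ j, x.coord j ≠ y.coord j) :
    ∃ j, x.coord j ≠ y.coord j ∧ ∀ k < j, x.coord k = y.coord k := by
  refine ⟨wellFounded_lt.min {j | x.coord j ≠ y.coord j} h, WellFounded.min_mem _ _ h, fun k hk => ?_⟩
  by_contra hne
  exact WellFounded.not_lt_min _ (s := {j | x.coord j ≠ y.coord j}) hne hk

/-- Points between two points that agree below `j` agree with them below `j`. -/
theorem coord_eq_of_between {x y z : TreeLine e Λ} (hxz : x ≤ z) (hzy : z ≤ y) {j : ι}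
    (h : ∀ k < j, x.coord k = y.coord k) :
    (∀ k < j, z.coord k = y.coord k) ∧ z.coord j ≤ y.coord j := by
  have key : ∀ k ≤ j, (∀ m < k, z.coord m = y.coord m) → z.coord k ≤ y.coord k := by
    intro k _ hm
    by_contra! hlt
    exact absurd hzy (not_le.2 (lt_iff.2 ⟨k, fun m hmk => (hm m hmk).symm, hlt⟩))
  have h1 : ∀ k < j, z.coord k = y.coord k := by
    intro k
    induction k using WellFoundedLT.induction with
    | _ k ih =>
    intro hk
    have hm : ∀ m < k, z.coord m = y.coord m := fun m hm => ih m hm (hm.trans hk)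
    refine le_antisymm (key k hk.le hm) ?_
    by_contra! hlt
    refine absurd hxz (not_le.2 (lt_iff.2 ⟨k, fun m hmk => ?_, (h k hk).symm ▸ hlt⟩))
    rw [hm m hmk, h m (hmk.trans hk)]
  exact ⟨h1, key j le_rfl h1⟩

/-- The types range over a countable set. Traces are taken with the point of smaller level first;
the Boolean records whether the coordinates were exchanged for this. -/
theorem exists_isChainCover (he : IsCoherentSeq e) :
    ∃ K : ℕ → Set (TreeLine e Λ × TreeLine e Λ), IsChainCover K := by
  classical
  have hex : ∀ x y : TreeLine e Λ, ∃ t : ℕ × Finset ι,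
      x.level ≤ y.level → IsTrace x.level x.coord y.coord t.1 t.2 := by
    intro x y
    by_cases h : x.level ≤ y.level
    · obtain ⟨n, F, hF⟩ := x.isPoint.exists_isTrace he y.isPoint h
      exact ⟨(n, F), fun _ => hF⟩
    · exact ⟨(0, ∅), fun h' => absurd h' h⟩
  choose t ht using hex
  let g : TreeLine e Λ → TreeLine e Λ → ℕ × Finset (ℕ × Val × Val) := fun x y =>
    ((t x y).1, traceType x.coord y.coord (t x y).2)
  have core : ∀ x y x' y' : TreeLine e Λ, x.level ≤ y.level → x'.level ≤ y'.level → g x y = g x' y' →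
      ¬ (x < x' ∧ y' < y) := by
    intro x y x' y' h h' hg
    have h1 := ht x y h
    have h2 := ht x' y' h'
    rw [← (Prod.mk.inj hg).1] at h2
    exact not_lt_and_gt_of_traceType_eq x.isPoint y.isPoint h x'.isPoint h1 h2 (Prod.mk.inj hg).2
  have core' : ∀ x y x' y' : TreeLine e Λ, x.level ≤ y.level → x'.level ≤ y'.level →
      g x y = g x' y' → (x ≤ x' ∧ y ≤ y') ∨ (x' ≤ x ∧ y' ≤ y) := by
    intro x y x' y' h h' hg
    rcases le_total x x' with hx | hx <;> rcases le_total y y' with hy | hy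
    · exact Or.inl ⟨hx, hy⟩
    · rcases hx.eq_or_lt with hx | hx
      · exact Or.inr ⟨hx.ge, hy⟩
      rcases hy.eq_or_lt with hy | hy
      · exact Or.inl ⟨hx.le, hy.ge⟩
      exact absurd ⟨hx, hy⟩ (core x y x' y' h h' hg)
    · rcases hx.eq_or_lt with hx | hx
      · exact Or.inl ⟨hx.ge, hy⟩
      rcases hy.eq_or_lt with hy | hy
      · exact Or.inr ⟨hx.le, hy.ge⟩
      exact absurd ⟨hx, hy⟩ (core x' y' x y h' h hg.symm)
    · exact Or.inr ⟨hx, hy⟩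
  let τ : TreeLine e Λ × TreeLine e Λ → Bool × ℕ × Finset (ℕ × Val × Val) := fun q =>
    if q.1.level ≤ q.2.level then (true, g q.1 q.2) else (false, g q.2 q.1)
  obtain ⟨c, hc⟩ := exists_injective_nat (Bool × ℕ × Finset (ℕ × Val × Val))
  refine ⟨fun n => {q | c (τ q) = n}, fun n q hq r hr _ => ?_, fun q => ⟨_, rfl⟩⟩
  have hτ : τ q = τ r := hc (Eq.trans hq (Eq.symm hr))
  by_cases h1 : q.1.level ≤ q.2.level <;> by_cases h2 : r.1.level ≤ r.2.level
  · simp only [τ, if_pos h1, if_pos h2] at hτ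
    exact core' _ _ _ _ h1 h2 (Prod.mk.inj hτ).2
  · simp [τ, if_pos h1, if_neg h2] at hτ
  · simp [τ, if_neg h1, if_pos h2] at hτ
  · simp only [τ, if_neg h1, if_neg h2] at hτ
    exact (core' _ _ _ _ (not_le.1 h1).le (not_le.1 h2).le (Prod.mk.inj hτ).2).imp
      (fun h => ⟨h.2, h.1⟩) (fun h => ⟨h.2, h.1⟩)

omit [WellFoundedLT ι] in
-- A point of level `i` is determined by the finite part of its graph up to `i` that differs from `e
-- i`.
theorem countable_level (hι : ∀ i : ι, (Iic i).Countable) (i : ι) :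
    {x : TreeLine e Λ | x.level = i}.Countable := by
  let s : Set (ι × Val) := Iic i ×ˢ Set.univ
  have hs : s.Countable := (hι i).prod Set.countable_univ
  let f : TreeLine e Λ → Set (ι × Val) := fun x =>
    {q | q.1 ≤ i ∧ q.2 = x.coord q.1 ∧ q.2 ≠ Val.ofNat (e i q.1)}
  refine Set.MapsTo.countable_of_injOn (f := f) (t := {t | t.Finite ∧ t ⊆ s}) ?_ ?_
    (Set.countable_ofPred_finite_subset hs)
  · rintro x rfl
    refine ⟨?_, fun q hq => ⟨hq.1, mem_univ _⟩⟩
    refine ((x.isPoint.finite_ne.union (Set.finite_singleton x.level)).image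
      fun j => (j, x.coord j)).subset ?_
    rintro ⟨j, p⟩ ⟨hj, h1, h2⟩
    change j ≤ x.level at hj
    change p = x.coord j at h1
    subst h1
    refine ⟨j, ?_, rfl⟩
    rcases hj.eq_or_lt with rfl | hj
    · exact Or.inr rfl
    · exact Or.inl ⟨hj, h2⟩
  · rintro x hx y hy hxy
    change x.level = i at hx
    change y.level = i at hy
    refine ext (funext fun j => ?_)
    by_cases hj : j ≤ i
    swap
    · rw [x.isPoint.eq_top j (hx ▸ not_le.1 hj), y.isPoint.eq_top j (hy ▸ not_le.1 hj)]
    have h1 : ∀ p, (j, p) ∈ f x ↔ (j, p) ∈ f y := fun p => by rw [hxy]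
    by_contra hne
    by_cases h2 : x.coord j = Val.ofNat (e i j)
    · have h3 := (h1 (y.coord j)).2 ⟨hj, rfl, fun h => hne (h2.trans h.symm)⟩
      exact hne h3.2.1.symm
    · have h3 := (h1 (x.coord j)).1 ⟨hj, rfl, h2⟩
      exact hne h3.2.1

end TreeLine

end TreeLine

/-! ### Density and complementary intervals of the tree lines -/

namespace TreeLine

variable {ι : Type u} [LinearOrder ι] [WellFoundedLT ι] {e : ι → ι → ℕ} {Λ : Set ι}

/-- At the first difference `j`, put a value strictly between the two and continue along `e k`: this
gives a point of the interval on every level `k > j`. -/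
theorem not_countable_Icc (he : IsCoherentSeq e) (hunc : ∀ j : ι, ¬ (Ioi j).Countable)
    {x y : TreeLine e Λ} (hxy : x < y) : ¬ (Icc x y).Countable := by
  obtain ⟨j, hj, hlt⟩ := lt_iff.1 hxy
  obtain ⟨p, hp1, hp2⟩ := exists_between hlt
  have hbot : ⊥ < p := bot_le.trans_lt hp1
  have htop : p < ⊤ := hp2.trans_le le_top
  have hjx : j ≤ x.level := lt_top_iff.1 (hp1.trans htop)
  intro hc
  refine hunc j ((hc.image level).mono fun k hk => ?_)
  have hpt := isPoint_extendFun he x.isPoint hjx hk htop hbot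
  refine ⟨mk hpt fun h => absurd h ?_, ⟨le_of_lt (lt_iff.2 ⟨j, fun m hm => ?_, ?_⟩),
    le_of_lt (lt_iff.2 ⟨j, fun m hm => ?_, ?_⟩)⟩, level_mk _ _⟩
  · have hk' : j < k := hk
    simpa [extendFun, hk'.not_gt, hk'.ne'] using (Val.bot_lt_ofNat _).ne'
  · simp [coord_mk, extendFun, hm]
  · simpa [coord_mk, extendFun] using hp1
  · simpa [coord_mk, extendFun, hm] using hj m hm
  · simpa [coord_mk, extendFun] using hp2

omit [WellFoundedLT ι] in
theorem uncountable (hunc : ∀ j : ι, ¬ (Ioi j).Countable) (i : ι) : Uncountable (TreeLine e Λ) := by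
  rw [← not_countable_iff]
  intro h
  refine hunc i ((Set.countable_range (level : TreeLine e Λ → ι)).mono fun k _ => ?_)
  exact ⟨base e Λ k, level_base k⟩

theorem isCountryman (he : IsCoherentSeq e) (hunc : ∀ j : ι, ¬ (Ioi j).Countable) (i : ι) :
    IsCountryman (TreeLine e Λ) := by
  obtain ⟨K, h1, h2⟩ := exists_isChainCover (Λ := Λ) he
  exact ⟨uncountable hunc i, K, h1, eq_univ_of_forall fun q => mem_iUnion.2 (h2 q)⟩

theorem exists_lt (he : IsCoherentSeq e) (x : TreeLine e Λ) {j : ι} (hj : j ≤ x.level)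
    (hΛ : j ∉ Λ) : ∃ y < x, (∀ k < j, y.coord k = x.coord k) ∧ y.level = j := by
  obtain ⟨p, h1, h2⟩ := exists_between (bot_lt hj hΛ)
  refine ⟨cut he x hj (h2.trans_le le_top) fun h => absurd h h1.ne',
    lt_iff.2 ⟨j, fun k hk => coord_cut_of_lt he hj _ _ hk, ?_⟩,
    fun k hk => coord_cut_of_lt he hj _ _ hk, level_cut ..⟩
  rwa [coord_cut_self]

theorem exists_gt (he : IsCoherentSeq e) (x : TreeLine e Λ) {j : ι} (hj : j ≤ x.level) :
    ∃ y, x < y ∧ (∀ k < j, y.coord k = x.coord k) ∧ y.level = j := by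
  obtain ⟨p, h1, h2⟩ := exists_between (lt_top_iff.2 hj)
  refine ⟨cut he x hj h2 fun h => absurd h (bot_le.trans_lt h1).ne',
    lt_iff.2 ⟨j, fun k hk => (coord_cut_of_lt he hj _ _ hk).symm, ?_⟩,
    fun k hk => coord_cut_of_lt he hj _ _ hk, level_cut ..⟩
  rwa [coord_cut_self]

/-- The first point of a class. -/
theorem exists_first (he : IsCoherentSeq e) (x : TreeLine e Λ) {j : ι} (hj : j ≤ x.level)
    (hΛ : j ∈ Λ) : ∃ m : TreeLine e Λ, (∀ k < j, m.coord k = x.coord k) ∧ m.level = j ∧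
      ∀ y : TreeLine e Λ, (∀ k < j, y.coord k = x.coord k) → j ≤ y.level → m ≤ y := by
  refine ⟨cut he x hj (bot_le.trans_lt (lt_top_iff.2 hj) : (⊥ : Val) < ⊤) fun _ => hΛ,
    fun k hk => coord_cut_of_lt he hj _ _ hk, level_cut .., fun y hy hjy => ?_⟩
  rcases (bot_le (a := y.coord j)).eq_or_lt with h | h
  · have hyj : y.level = j := by
      by_contra hne
      exact absurd (y.isPoint.bot_lt j (lt_of_le_of_ne hjy (Ne.symm hne))) (h ▸ lt_irrefl _)
    refine le_of_eq (ext (funext fun k => ?_))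
    rcases lt_trichotomy k j with hk | rfl | hk
    · rw [coord_cut_of_lt _ _ _ _ hk, hy k hk]
    · rw [coord_cut_self, h]
    · rw [coord_cut_of_gt _ _ _ _ hk, y.isPoint.eq_top k (hyj ▸ hk)]
  · refine le_of_lt (lt_iff.2 ⟨j, fun k hk => ?_, by rwa [coord_cut_self]⟩)
    rw [coord_cut_of_lt _ _ _ _ hk, hy k hk]

/-- The points of level below `o ξ`. -/
def below {o : OmegaOne → ι} (ξ : OmegaOne) : Set (TreeLine e Λ) := {x | x.level < o ξ}

section Index

variable {o : OmegaOne → ι} {i₀ : ι}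

/-- Points that first differ at some `j < o ξ` are separated by a point of level `j` with an
intermediate last value. If they agree below `o ξ`, every point between them agrees too and has a
value below `⊤` at `o ξ`, hence level at least `o ξ`. -/
theorem mem_gapClass_below_iff (he : IsCoherentSeq e) {ξ : OmegaOne} {x y : TreeLine e Λ}
    (hx : o ξ ≤ x.level) : y ∈ gapClass (below (o := o) ξ) x ↔
      (∀ k < o ξ, y.coord k = x.coord k) ∧ o ξ ≤ y.level := by
  have between : ∀ a b : TreeLine e Λ, (∀ k < o ξ, a.coord k = b.coord k) → o ξ ≤ b.level → a ≤ b →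
      Disjoint (uIcc a b) (below (o := o) ξ) := by
    intro a b hab hb hle
    refine Set.disjoint_left.2 fun c hc hcl => ?_
    rw [uIcc_of_le hle] at hc
    have h1 := (coord_eq_of_between hc.1 hc.2 hab).2
    exact absurd (lt_top_iff.1 (h1.trans_lt (lt_top_iff.2 hb))) (not_le.2 hcl)
  have split : ∀ a b : TreeLine e Λ, o ξ ≤ a.level → o ξ ≤ b.level → ∀ j < o ξ,
      (∀ k < j, a.coord k = b.coord k) → a.coord j < b.coord j →
      ¬ Disjoint (uIcc a b) (below (o := o) ξ) := by
    intro a b ha hb j hj hab hlt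
    obtain ⟨p, hp1, hp2⟩ := exists_between hlt
    have hja : j ≤ a.level := hj.le.trans ha
    have hpt : p < ⊤ := hp2.trans_le le_top
    have hpb : p = ⊥ → j ∈ Λ := fun h => absurd h (bot_le.trans_lt hp1).ne'
    refine Set.not_disjoint_iff.2 ⟨cut he a hja hpt hpb, mem_uIcc_of_le' ?_ ?_, ?_⟩
    · refine le_of_lt (lt_iff.2 ⟨j, fun k hk => (coord_cut_of_lt he hja hpt hpb hk).symm, ?_⟩)
      rwa [coord_cut_self]
    · refine le_of_lt (lt_iff.2 ⟨j, fun k hk => ?_, ?_⟩)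
      · rw [coord_cut_of_lt _ _ _ _ hk, hab k hk]
      · rwa [coord_cut_self]
    · change level _ < o ξ
      rwa [level_cut]
  constructor
  · intro h
    have hy : o ξ ≤ y.level := not_lt.1 fun h1 => notMem_of_mem_gapClass h h1
    refine ⟨?_, hy⟩
    by_contra! hne
    obtain ⟨k, hk, hne⟩ := hne
    obtain ⟨j, hj, hmin⟩ := exists_first_difference ⟨k, hne⟩
    have hjo : j < o ξ := by
      by_contra! h1
      exact hne (hmin k (hk.trans_le h1))
    rcases lt_or_gt_of_ne hj with h1 | h1
    · refine split y x hy hx j hjo hmin h1 ?_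
      rw [uIcc_comm]
      exact h
    · exact split x y hx hy j hjo (fun k hk => (hmin k hk).symm) h1 h
  · rintro ⟨h1, h2⟩
    rcases le_total x y with h | h
    · exact between x y (fun k hk => (h1 k hk).symm) h2 h
    · exact mem_gapClass_comm.1 (between y x h1 hx h)

omit [WellFoundedLT ι] in
theorem not_mem_below {ξ : OmegaOne} {x : TreeLine e Λ} :
    x ∉ below (o := o) ξ ↔ o ξ ≤ x.level := not_lt

theorem leftSet_below_subset (he : IsCoherentSeq e) :
    leftSet (fun ξ => (below (o := o) ξ : Set (TreeLine e Λ))) ⊆ o ⁻¹' Λ := by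
  rintro ξ ⟨I, hI, a, ha, hmin⟩
  by_contra hΛ
  have hI' := hI.eq_gapClass ha
  have haX : o ξ ≤ a.level := not_mem_below.1 (Set.disjoint_left.1 hI.1.2.2 ha)
  obtain ⟨y, hya, h1, h2⟩ := exists_lt he a haX hΛ
  refine absurd (hmin ?_) (not_le.2 hya)
  rw [hI', mem_gapClass_below_iff he haX]
  exact ⟨h1, h2.ge⟩

theorem subset_leftHatSet_below (he : IsCoherentSeq e) :
    o ⁻¹' Λ ⊆ leftHatSet (fun ξ => (below (o := o) ξ : Set (TreeLine e Λ))) := by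
  intro ξ hΛ I hI
  obtain ⟨x, hx, rfl⟩ := hI.exists_eq_gapClass
  rw [not_mem_below] at hx
  obtain ⟨m, h1, h2, h3⟩ := exists_first he x hx hΛ
  refine ⟨m, (mem_gapClass_below_iff he hx).2 ⟨h1, h2.ge⟩, fun y hy => ?_⟩
  obtain ⟨h4, h5⟩ := (mem_gapClass_below_iff he hx).1 hy
  exact h3 y h4 h5

theorem leftHatSet_below_subset :
    leftHatSet (fun ξ => (below (o := o) ξ : Set (TreeLine e Λ))) ⊆
      leftSet fun ξ => (below (o := o) ξ : Set (TreeLine e Λ)) := by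
  intro ξ hξ
  have h : base e Λ (o ξ) ∉ below (o := o) ξ := not_mem_below.2 (level_base _).ge
  exact ⟨_, isComplementaryInterval_gapClass h, hξ _ (isComplementaryInterval_gapClass h)⟩

theorem rightSet_below (he : IsCoherentSeq e) :
    rightSet (fun ξ => (below (o := o) ξ : Set (TreeLine e Λ))) = ∅ := by
  refine Set.eq_empty_of_forall_notMem ?_
  rintro ξ ⟨I, hI, a, ha, hmax⟩
  have hI' := hI.eq_gapClass ha
  have haX : o ξ ≤ a.level := not_mem_below.1 (Set.disjoint_left.1 hI.1.2.2 ha)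
  obtain ⟨y, hya, h1, h2⟩ := exists_gt he a haX
  refine absurd (hmax ?_) (not_le.2 hya)
  rw [hI', mem_gapClass_below_iff he haX]
  exact ⟨h1, h2.ge⟩

theorem isDecomposition_below (ho : StrictMono o) (h0 : ∀ ξ, i₀ < o ξ)
    (hcov : ∀ i, i = i₀ ∨ ∃ ξ, i = o ξ) (hι : ∀ i : ι, (Iic i).Countable) :
    IsDecomposition (fun ξ => (below (o := o) ξ : Set (TreeLine e Λ))) := by
  have hmono : Monotone (fun ξ => (below (o := o) ξ : Set (TreeLine e Λ))) :=
    fun ξ ξ' h x hx => lt_of_lt_of_le hx (ho.monotone h)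
  refine ⟨hmono, fun ξ => ?_, fun ξ hξ => ?_, ?_⟩
  · refine ((hι (o ξ)).biUnion fun i _ => countable_level (e := e) (Λ := Λ) hι i).mono fun x hx => ?_
    exact mem_biUnion (x := x.level) (le_of_lt hx) rfl
  · refine Set.Subset.antisymm (fun x hx => ?_) (iUnion_subset fun η => hmono (le_of_lt η.2))
    change x.level < o ξ at hx
    rcases hcov x.level with h | ⟨η, h⟩
    · have hpos : ⊥ < ξ := bot_lt_iff_ne_bot.2 fun h => hξ.1 (h ▸ isMin_bot)
      exact mem_iUnion.2 ⟨⟨⊥, hpos⟩, show x.level < o ⊥ from h ▸ h0 ⊥⟩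
    · rw [h, ho.lt_iff_lt] at hx
      obtain ⟨η', h1, h2⟩ := (not_covBy_iff hx).1 (hξ.2 η)
      exact mem_iUnion.2 ⟨⟨η', h2⟩, show x.level < o η' from h ▸ ho h1⟩
  · refine eq_univ_of_forall fun x => ?_
    rcases hcov x.level with h | ⟨η, h⟩
    · exact mem_iUnion.2 ⟨⊥, show x.level < o ⊥ from h ▸ h0 ⊥⟩
    · obtain ⟨ζ, hζ⟩ := NoMaxOrder.exists_gt η
      exact mem_iUnion.2 ⟨ζ, show x.level < o ζ from h ▸ ho hζ⟩

/-- The whole line is the class at `i₀`, so the absence of a minimum comes from `i₀ ∉ Λ`. -/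
theorem isAlephOneDense (he : IsCoherentSeq e) (hi₀ : ∀ i, i₀ ≤ i) (hΛ : i₀ ∉ Λ)
    (hunc : ∀ j : ι, ¬ (Ioi j).Countable) {D : OmegaOne → Set (TreeLine e Λ)}
    (hD : IsDecomposition D) : IsAlephOneDense (TreeLine e Λ) := by
  refine ⟨⟨base e Λ i₀⟩, ⟨fun x => ?_⟩, ⟨fun x => ?_⟩, fun a b hab => le_antisymm ?_ ?_⟩
  · obtain ⟨y, hy, -⟩ := exists_lt he x (hi₀ _) hΛ
    exact ⟨y, hy⟩
  · obtain ⟨y, hy, -⟩ := exists_gt he x (hi₀ _)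
    exact ⟨y, hy⟩
  · exact (Cardinal.mk_set_le _).trans hD.mk_le
  · rw [← Cardinal.succ_aleph0, Order.succ_le_iff, ← not_le, Cardinal.le_aleph0_iff_set_countable]
    exact not_countable_Icc he hunc hab

end Index

end TreeLine

/-- A well-order with a copy of `ω₁` above a least element. -/
theorem exists_index : ∃ (ι : Type u) (_ : LinearOrder ι) (_ : WellFoundedLT ι)
    (o : OmegaOne → ι) (i₀ : ι), StrictMono o ∧ (∀ ξ, i₀ < o ξ) ∧ ∀ i, i = i₀ ∨ ∃ ξ, i = o ξ := by
  refine ⟨ULift.{u} (WithBot (ω₁ : Ordinal.{0}).ToType), inferInstance, inferInstance,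
    fun ξ => ⟨(Ordinal.ToType.mk ξ : (ω₁ : Ordinal.{0}).ToType)⟩, ⟨⊥⟩, fun ξ η h => ?_, fun ξ => ?_,
    fun i => ?_⟩
  · exact WithBot.coe_lt_coe.2 (Ordinal.ToType.mk.strictMono h)
  · exact WithBot.bot_lt_coe _
  · obtain ⟨i⟩ := i
    induction i using WithBot.recBotCoe with
    | bot => exact Or.inl rfl
    | coe w =>
      refine Or.inr ⟨Ordinal.ToType.mk.symm w, ?_⟩
      simp

/-! ### The family of lines and the main theorem -/

theorem exists_isCountrymanFamily (S : OmegaOne → Set OmegaOne) :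
    ∃ (T : Type u) (_ : LinearOrder T) (C : OmegaOne → Type u) (_ : ∀ α, LinearOrder (C α))
      (D : ∀ α, OmegaOne → Set (C α)), IsCountrymanFamily S T C D := by
  obtain ⟨ι, _, _, o, i₀, ho, h0, hcov⟩ := exists_index.{u}
  have hi₀ : ∀ i, i₀ ≤ i := fun i => by
    rcases hcov i with h | ⟨ξ, h⟩
    · exact h.ge
    · exact h ▸ (h0 ξ).le
  have hIic : ∀ i : ι, (Iic i).Countable := by
    intro i
    rcases hcov i with rfl | ⟨ξ, rfl⟩
    · exact (Set.countable_singleton i).mono fun j hj => le_antisymm hj (hi₀ j)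
    · refine ((Set.countable_singleton i₀).union ((OmegaOne.countable_Iic ξ).image o)).mono
        fun j hj => ?_
      rcases hcov j with h | ⟨η, rfl⟩
      · exact Or.inl h
      · exact Or.inr ⟨η, ho.le_iff_le.1 hj, rfl⟩
  have hunc : ∀ j : ι, ¬ (Ioi j).Countable := by
    intro j hj
    obtain ⟨η, hη⟩ : ∃ η, j ≤ o η := by
      rcases hcov j with rfl | ⟨η, rfl⟩
      · exact ⟨⊥, (h0 ⊥).le⟩
      · exact ⟨η, le_rfl⟩
    exact OmegaOne.not_countable_Ioi η ((hj.preimage ho.injective).mono fun ξ hξ =>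
      lt_of_le_of_lt hη (ho hξ))
  obtain ⟨e, he⟩ := exists_isCoherentSeq fun i : ι => (hIic i).mono Iio_subset_Iic_self
  let Λ : OmegaOne → Set ι := fun α => o '' ⋃ ξ : Iio α, S ξ
  -- The extra level `i₀` keeps the lines without a minimum even when `⊥` belongs to some `S ξ`.
  have hΛ : ∀ α, i₀ ∉ Λ α := by
    rintro α ⟨ξ, -, h⟩
    exact (h0 ξ).ne' h
  have hΛo : ∀ α, o ⁻¹' Λ α = ⋃ ξ : Iio α, S ξ := fun α => preimage_image_eq _ ho.injective
  have hdec := fun α => TreeLine.isDecomposition_below (e := e) (Λ := Λ α) ho h0 hcov hIic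
  have h1 := fun α => TreeLine.leftSet_below_subset (Λ := Λ α) (o := o) he
  have h2 := fun α => TreeLine.subset_leftHatSet_below (Λ := Λ α) (o := o) he
  have h3 := fun α => TreeLine.leftHatSet_below_subset (e := e) (Λ := Λ α) (o := o)
  refine ⟨TreeLine e Set.univ, inferInstance, fun α => TreeLine e (Λ α), fun α => inferInstance,
    fun α ξ => TreeLine.below (o := o) ξ, ?_⟩
  exact
    { countryman_ambient := TreeLine.isCountryman he hunc i₀
      embeds := fun α => ⟨_, TreeLine.strictMono_inclusion (Set.subset_univ _)⟩
      countryman := fun α => TreeLine.isCountryman he hunc i₀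
      dense := fun α => TreeLine.isAlephOneDense he hi₀ (hΛ α) hunc (hdec α)
      decomposition := hdec
      left_eq := fun α => hΛo α ▸ (h1 α).antisymm ((h2 α).trans (h3 α))
      leftHat_eq := fun α => hΛo α ▸ ((h3 α).trans (h1 α)).antisymm (h2 α)
      right_eq := fun α => TreeLine.rightSet_below he }

theorem mainTheorem7 (hMA : MartinAxiomAlephOne.{u}) :
    (∀ S : OmegaOne → Set OmegaOne,
      (∀ α, IsStationary (S α)) → (∀ α β, α ≠ β → Disjoint (S α) (S β)) →
      (∃ (T : Type u) (_ : LinearOrder T) (C : OmegaOne → Type u) (_ : ∀ α, LinearOrder (C α))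
          (D : ∀ α, OmegaOne → Set (C α)), IsCountrymanFamily S T C D) ∧
      (∀ (T : Type u) [LinearOrder T] (C : OmegaOne → Type u) [∀ α, LinearOrder (C α)]
          (D : ∀ α, OmegaOne → Set (C α)), IsCountrymanFamily S T C D →
        ∀ α β, α < β → EpiLT (C β) (C α))) ∧
    (∃ (C : OmegaOne → Type u) (_ : ∀ α, LinearOrder (C α)),
      (∀ α, IsCountryman (C α)) ∧ ∀ α β, α < β → EpiLT (C β) (C α)) := by
  refine ⟨fun S hst hdisj => ⟨exists_isCountrymanFamily S, fun T _ C _ D h α β hαβ =>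
    h.epiLT hMA hst hdisj hαβ⟩, ?_⟩
  obtain ⟨S, hst, hdisj⟩ := OmegaOne.exists_disjoint_stationary
  obtain ⟨T, _, C, _, D, h⟩ := exists_isCountrymanFamily.{u} S
  exact ⟨C, inferInstance, h.countryman, fun α β hαβ => h.epiLT hMA hst hdisj hαβ⟩
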